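/- Let $\mathcal A$ be a finite non-empty set of agents and $\mathcal R$ a finite set of resources. Each agent $a$ has an additive utility function $u_a$ given by $u_a\colon\mathcal R\to\mathbb N_0$, $u_a(S)=\sum_{r\in S}u_a(r)$. Let $\pi\colon\mathcal A\to 2^{\mathcal R}$ be a complete allocation (the bundles $\pi(a)$ are pairwise disjoint and cover $\mathcal R$), let $\mathcal G_s=(\mathcal A,\mathcal E_s)$ be a simple undirected graph (the sharing graph), and let $k\in\mathbb N_0$. A sharing is a map $\delta\colon\mathcal E_s\to 2^{\mathcal R}$ with $\delta(\{a,a'\})\subseteq\pi(a)\cup\pi(a')$ for every edge $\{a,a'\}$; it induces the bundles $\Pi^\delta(a)=\pi(a)\cup\bigcup_{e\ni a}\delta(e)$. It is a simple $2$-sharing (a $1$-bounded $2$-sharing) if $\Pi^\delta(a)\cap\Pi^\delta(a')\cap\Pi^\delta(a'')=\emptyset$ for any three distinct agents and $\left|\bigcup_{e\ni a}\delta(e)\right|\le 1$ for every agent $a$. The problem $1$-EWSA (1-bounded egalitarian welfare sharing allocation) asks, given $(\mathcal A,\mathcal R,(u_a)_a,\pi,\mathcal G_s,k)$ with numbers written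 in binary, whether there is a simple $2$-sharing $\delta$ with $\min_{a\in\mathcal A}u_a(\Pi^\delta(a))\ge k$. **Lemma.** $1$-EWSA is solvable in polynomial time. Moreover, let $\mathcal A^+_k=\{a: u_a(\pi(a))\ge k\}$ and $\mathcal A^-_k=\{a: u_a(\pi(a))<k\}$, and let $G_k$ be the graph on $\mathcal A$ whose edges are the pairs $\{a,b\}\in\mathcal E_s$ with $a\in\mathcal A^+_k$, $b\in\mathcal A^-_k$ for which some $r\in\pi(a)$ satisfies $u_b(\pi(b))+u_b(r)\ge k$. Then $G_k$ is bipartite with parts $\mathcal A^+_k$ and $\mathcal A^-_k$, and the answer to the instance is yes if and only if $G_k$ has a matching of size $|\mathcal A^-_k|$. -/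

import Mathlib

/-! ## Random access machines with logarithmic cost -/

namespace RAM

/-- Memory of a random access machine: registers, and arrays that are addressed indirectly.
Every cell holds a natural number of arbitrary size. -/
structure Memory where
  reg : ℕ → ℕ
  arr : ℕ → ℕ → ℕ

/-- Put `v` into register `x`. -/
def Memory.setReg (s : Memory) (x v : ℕ) : Memory :=
  { s with reg := Function.update s.reg x v }

/-- Put `v` into cell `i` of array `a`. -/
def Memory.setArr (s : Memory) (a i v : ℕ) : Memory :=
  { s with arr := Function.update s.arr a (Function.update (s.arr a) i v) }

/-- Programs. A program is a finite object, so it names only finitely many registers and arrays.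
Arithmetic is restricted to addition and truncated subtraction. -/
inductive Prog : Type
  /-- do nothing -/
  | skip : Prog
  /-- `x := c` -/
  | const (x c : ℕ) : Prog
  /-- `x := y + z` -/
  | add (x y z : ℕ) : Prog
  /-- `x := y - z` (zero if `y < z`) -/
  | sub (x y z : ℕ) : Prog
  /-- `x := a[y]` -/
  | load (x a y : ℕ) : Prog
  /-- `a[x] := y` -/
  | store (a x y : ℕ) : Prog
  /-- first `p`, then `q` -/
  | seq (p q : Prog) : Prog
  /-- if register `x` is nonzero then `p` else `q` -/
  | ite (x : ℕ) (p q : Prog) : Prog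
  /-- while register `x` is nonzero do `p` -/
  | loop (x : ℕ) (p : Prog) : Prog

/-- `Run p s c t`: started on memory `s`, the program `p` halts with memory `t`, at total cost `c`.
The cost is logarithmic: every instruction and every test costs one plus the bit lengths
(`Nat.size`) of all the numbers it handles, array indices included. -/
inductive Run : Prog → Memory → ℕ → Memory → Prop
  | skip (s : Memory) : Run .skip s 1 s
  | const (s : Memory) (x c : ℕ) :
      Run (.const x c) s (1 + c.size) (s.setReg x c)
  | add (s : Memory) (x y z : ℕ) :
      Run (.add x y z) s (1 + (s.reg y).size + (s.reg z).size)
        (s.setReg x (s.reg y + s.reg z))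
  | sub (s : Memory) (x y z : ℕ) :
      Run (.sub x y z) s (1 + (s.reg y).size + (s.reg z).size)
        (s.setReg x (s.reg y - s.reg z))
  | load (s : Memory) (x a y : ℕ) :
      Run (.load x a y) s (1 + (s.reg y).size + (s.arr a (s.reg y)).size)
        (s.setReg x (s.arr a (s.reg y)))
  | store (s : Memory) (a x y : ℕ) :
      Run (.store a x y) s (1 + (s.reg x).size + (s.reg y).size)
        (s.setArr a (s.reg x) (s.reg y))
  | seq {p q : Prog} {s t w : Memory} {c d : ℕ} (hp : Run p s c t) (hq : Run q t d w) :
      Run (.seq p q) s (c + d) w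
  | ite_true {x : ℕ} {p q : Prog} {s t : Memory} {c : ℕ} (hx : s.reg x ≠ 0)
      (hp : Run p s c t) : Run (.ite x p q) s (1 + (s.reg x).size + c) t
  | ite_false {x : ℕ} {p q : Prog} {s t : Memory} {c : ℕ} (hx : s.reg x = 0)
      (hq : Run q s c t) : Run (.ite x p q) s (1 + (s.reg x).size + c) t
  | loop_done {x : ℕ} {p : Prog} {s : Memory} (hx : s.reg x = 0) :
      Run (.loop x p) s (1 + (s.reg x).size) s
  | loop_step {x : ℕ} {p : Prog} {s t w : Memory} {c d : ℕ} (hx : s.reg x ≠ 0)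
      (hp : Run p s c t) (hl : Run (.loop x p) t d w) :
      Run (.loop x p) s (1 + (s.reg x).size + c + d) w

/-- Initial memory on an input word: the input is in array `0`, its length in register `0`, and
all other cells are zero. -/
def init (w : List ℕ) : Memory where
  reg := fun x => if x = 0 then w.length else 0
  arr := fun a i => if a = 0 then w.getD i 0 else 0

/-- Bit length of an input word, numbers being written in binary, with one separator each. -/
def inputSize (w : List ℕ) : ℕ := (w.map fun a => a.size + 1).sum

/-- The decision problem `P`, with instances of type `α` presented through the encoding `enc`, is
solvable in polynomial time: one program halts on every instance within a cost that is polynomial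
in the bit length of the instance, and leaves the answer (`1` for yes, `0` for no) in
register `0`. -/
def SolvableInPolyTime {α : Type*} (enc : α → List ℕ) (P : α → Prop) : Prop :=
  ∃ (p : Prog) (q : Polynomial ℕ), ∀ x : α, ∃ (c : ℕ) (t : Memory),
    Run p (init (enc x)) c t ∧ c ≤ q.eval (inputSize (enc x)) ∧
      (P x → t.reg 0 = 1) ∧ (¬ P x → t.reg 0 = 0)

end RAM

/-! ## Sharing allocations -/

namespace Sharing

/-- Agents `A` with additive utilities over resources `R`, an initial complete allocation, a
sharing graph and a target value. -/
structure Instance (A R : Type*) where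
  /-- `utility a r` is the value of resource `r` for agent `a` -/
  utility : A → R → ℕ
  /-- the initial allocation -/
  alloc : A → Finset R
  alloc_disjoint : ∀ a b, a ≠ b → Disjoint (alloc a) (alloc b)
  alloc_complete : ∀ r, ∃ a, r ∈ alloc a
  /-- the sharing graph -/
  graph : SimpleGraph A
  /-- the target value -/
  target : ℕ

namespace Instance

variable {A R : Type*} [Fintype A] [Fintype R] (I : Instance A R)

/-- The value of a bundle for agent `a`. -/
def value (a : A) (S : Finset R) : ℕ := ∑ r ∈ S, I.utility a r

/-- Along every edge of the sharing graph only resources held by one of its ends are shared. -/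
def IsSharing (δ : I.graph.edgeSet → Finset R) : Prop :=
  ∀ e : I.graph.edgeSet, ∀ r ∈ δ e, ∃ a ∈ e.1, r ∈ I.alloc a

open Classical in
/-- The union of `δ e` over the edges `e` incident to `a`. -/
noncomputable def exchanged (δ : I.graph.edgeSet → Finset R) (a : A) : Finset R :=
  Finset.univ.filter fun r => ∃ e : I.graph.edgeSet, a ∈ e.1 ∧ r ∈ δ e

open Classical in
/-- The bundle of `a` in the sharing allocation induced by `δ`. -/
noncomputable def bundle (δ : I.graph.edgeSet → Finset R) (a : A) : Finset R :=
  I.alloc a ∪ I.exchanged δ a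

/-- No resource is in the bundles of three different agents. -/
def IsTwoSharing (δ : I.graph.edgeSet → Finset R) : Prop :=
  I.IsSharing δ ∧ ∀ a b c : A, a ≠ b → a ≠ c → b ≠ c →
    ∀ r, ¬ (r ∈ I.bundle δ a ∧ r ∈ I.bundle δ b ∧ r ∈ I.bundle δ c)

/-- A `2`-sharing in which every agent takes part in the sharing of at most `b` resources. -/
def IsBoundedTwoSharing (b : ℕ) (δ : I.graph.edgeSet → Finset R) : Prop :=
  I.IsTwoSharing δ ∧ ∀ a, (I.exchanged δ a).card ≤ b

/-- The least value that an agent assigns to its own bundle. -/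
noncomputable def egalitarianWelfare [Nonempty A] (B : A → Finset R) : ℕ :=
  Finset.univ.inf' Finset.univ_nonempty fun a => I.value a (B a)

/-- `b`-bounded egalitarian welfare sharing allocation, as a decision problem. -/
def EWSA [Nonempty A] (b : ℕ) : Prop :=
  ∃ δ : I.graph.edgeSet → Finset R,
    I.IsBoundedTwoSharing b δ ∧ I.target ≤ I.egalitarianWelfare (I.bundle δ)

/-- The agents whose initial bundle has value at least the target. -/
def upper : Finset A := Finset.univ.filter fun a => I.target ≤ I.value a (I.alloc a)

/-- The agents whose initial bundle has value below the target. -/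
def lower : Finset A := Finset.univ.filter fun a => I.value a (I.alloc a) < I.target

/-- `a` is an upper agent, `b` a lower agent, they are neighbours in the sharing graph, and some
resource of `a` would raise the value of `b` to the target. -/
def CanHelp (a b : A) : Prop :=
  a ∈ I.upper ∧ b ∈ I.lower ∧ I.graph.Adj a b ∧
    ∃ r ∈ I.alloc a, I.target ≤ I.value b (I.alloc b) + I.utility b r

/-- The undirected graph whose edges are the pairs of which one can help the other. -/
def helpGraph : SimpleGraph A where
  Adj a b := I.CanHelp a b ∨ I.CanHelp b a
  symm := ⟨fun _ _ h => h.symm⟩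
  loopless := ⟨fun _ h => I.graph.irrefl (h.elim (fun h => h.2.2.1) (fun h => h.2.2.1))⟩

end Instance

/-- Instances as inputs of algorithms: agents and resources are numbered, and there is at least one
agent. -/
structure NumberedInstance where
  n : ℕ
  m : ℕ
  inst : Instance (Fin (n + 1)) (Fin m)

open Classical in
/-- An instance as a word of numbers: the number of agents, the number of resources, the target,
then row by row the adjacency matrix of the sharing graph, the `0`-`1` matrix that says which agent
holds which resource, and the matrix of utilities. -/
noncomputable def NumberedInstance.encode (x : NumberedInstance) : List ℕ :=
  [x.n + 1, x.m, x.inst.target]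
    ++ ((List.finRange (x.n + 1)).flatMap fun a => (List.finRange (x.n + 1)).map fun b =>
        if x.inst.graph.Adj a b then 1 else 0)
    ++ ((List.finRange (x.n + 1)).flatMap fun a => (List.finRange x.m).map fun r =>
        if r ∈ x.inst.alloc a then 1 else 0)
    ++ ((List.finRange (x.n + 1)).flatMap fun a => (List.finRange x.m).map fun r =>
        x.inst.utility a r)

end Sharing

/-! In a simple sharing, an agent `b` below the target must gain a resource `r` from outside its
bundle, and the edge that carries `r` joins `b` to the holder `a` of `r`. As `a` takes part in
sharing one resource only, namely its own `r`, its bundle does not change; so `a` was above the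
target from the start, and `r` alone lifts `b`. Two agents below the target cannot use the same `a`,
since `r` would then lie in three bundles. Thus a solution yields an injective choice of helpers
(`helpable_of_ewsa`), such a choice yields a solution (`ewsa_of_helpable`), and it amounts to a
matching of `helpGraph` with one edge per lower agent (`exists_matching_of_helpable`,
`helpable_of_matching`).

The matching is decided by an auction among `N` agents: a lower agent without helper takes a
cheapest possible helper, possibly from another bidder, and raises its price by one. If a bidder
without object finds everything it wants priced at `N` or more, Hall's condition fails
(`Inv.not_perfect`). Each bid raises the sum of prices by one, so more than `N * N` rounds decide
the question; the length of the input word is such a number.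

For the time bound, the algorithm is written in a small language whose loops and products are
controlled by read-only registers. Its commands compile to machine code with polynomially many steps
(`Cmd.steps_compile`), and step counts turn into logarithmic cost because bit lengths grow by at
most one per instruction (`Steps.run`). -/

/-! ## Unit cost -/

namespace RAM

/-- `Steps p s n t`: started on memory `s`, the program `p` halts with memory `t` after `n`
instructions and tests. -/
inductive Steps : Prog → Memory → ℕ → Memory → Prop
  | skip (s : Memory) : Steps .skip s 1 s
  | const (s : Memory) (x c : ℕ) : Steps (.const x c) s 1 (s.setReg x c)
  | add (s : Memory) (x y z : ℕ) : Steps (.add x y z) s 1 (s.setReg x (s.reg y + s.reg z))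
  | sub (s : Memory) (x y z : ℕ) : Steps (.sub x y z) s 1 (s.setReg x (s.reg y - s.reg z))
  | load (s : Memory) (x a y : ℕ) : Steps (.load x a y) s 1 (s.setReg x (s.arr a (s.reg y)))
  | store (s : Memory) (a x y : ℕ) : Steps (.store a x y) s 1 (s.setArr a (s.reg x) (s.reg y))
  | seq {p q : Prog} {s t w : Memory} {c d : ℕ} (hp : Steps p s c t) (hq : Steps q t d w) :
      Steps (.seq p q) s (c + d) w
  | ite_true {x : ℕ} {p q : Prog} {s t : Memory} {c : ℕ} (hx : s.reg x ≠ 0)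
      (hp : Steps p s c t) : Steps (.ite x p q) s (1 + c) t
  | ite_false {x : ℕ} {p q : Prog} {s t : Memory} {c : ℕ} (hx : s.reg x = 0)
      (hq : Steps q s c t) : Steps (.ite x p q) s (1 + c) t
  | loop_done {x : ℕ} {p : Prog} {s : Memory} (hx : s.reg x = 0) : Steps (.loop x p) s 1 s
  | loop_step {x : ℕ} {p : Prog} {s t w : Memory} {c d : ℕ} (hx : s.reg x ≠ 0)
      (hp : Steps p s c t) (hl : Steps (.loop x p) t d w) : Steps (.loop x p) s (1 + c + d) w

/-- All numbers in memory have at most `V` bits. -/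
def Memory.BitBound (V : ℕ) (s : Memory) : Prop :=
  (∀ x, (s.reg x).size ≤ V) ∧ ∀ a i, (s.arr a i).size ≤ V

/-- A bound for the bit lengths of the constants in a program. -/
def Prog.constBits : Prog → ℕ
  | .const _ c => c.size
  | .seq p q => p.constBits + q.constBits
  | .ite _ p q => p.constBits + q.constBits
  | .loop _ p => p.constBits
  | _ => 0

theorem Memory.BitBound.mono {V W : ℕ} {s : Memory} (h : s.BitBound V) (hVW : V ≤ W) :
    s.BitBound W :=
  ⟨fun x => (h.1 x).trans hVW, fun a i => (h.2 a i).trans hVW⟩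

theorem Memory.BitBound.setReg {V : ℕ} {s : Memory} (h : s.BitBound V) {x v : ℕ}
    (hv : v.size ≤ V) : (s.setReg x v).BitBound V := by
  refine ⟨fun y => ?_, h.2⟩
  by_cases hy : y = x
  · subst hy; simpa [Memory.setReg] using hv
  · simpa [Memory.setReg, hy] using h.1 y

theorem Memory.BitBound.setArr {V : ℕ} {s : Memory} (h : s.BitBound V) {a i v : ℕ}
    (hv : v.size ≤ V) : (s.setArr a i v).BitBound V := by
  refine ⟨h.1, fun b j => ?_⟩
  by_cases hb : b = a
  · subst hb
    by_cases hj : j = i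
    · subst hj; simpa [Memory.setArr] using hv
    · simpa [Memory.setArr, hj] using h.2 b j
  · simpa [Memory.setArr, hb] using h.2 b j

theorem size_add_le {a b V : ℕ} (ha : a.size ≤ V) (hb : b.size ≤ V) :
    (a + b).size ≤ V + 1 := by
  rw [Nat.size_le] at *
  rw [pow_succ]; omega

/-- Without multiplication the bit lengths grow by at most one per instruction, so that
the logarithmic cost is at most quadratic in the unit cost. -/
theorem Steps.run {p : Prog} {s t : Memory} {n : ℕ} (h : Steps p s n t) :
    ∀ V, p.constBits ≤ V → s.BitBound V →
      t.BitBound (V + n) ∧ ∃ c, Run p s c t ∧ c ≤ n * (1 + 2 * (V + n)) := by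
  induction h with
  | skip s => exact fun V _ hs => ⟨hs.mono (by omega), _, .skip s, by omega⟩
  | const s x c =>
    intro V hc hs
    simp only [Prog.constBits] at hc
    exact ⟨(hs.mono (by omega)).setReg (by omega), _, .const s x c, by omega⟩
  | add s x y z =>
    intro V _ hs
    have hy := hs.1 y
    have hz := hs.1 z
    exact ⟨(hs.mono (by omega)).setReg (size_add_le hy hz), _, .add s x y z, by omega⟩
  | sub s x y z =>
    intro V _ hs
    have hy := hs.1 y
    have hz := hs.1 z
    exact ⟨(hs.mono (by omega)).setReg
      ((Nat.size_le_size (Nat.sub_le _ _)).trans (by omega)), _, .sub s x y z, by omega⟩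
  | load s x a y =>
    intro V _ hs
    have hy := hs.1 y
    have hz := hs.2 a (s.reg y)
    exact ⟨(hs.mono (by omega)).setReg (by omega), _, .load s x a y, by omega⟩
  | store s a x y =>
    intro V _ hs
    have hy := hs.1 y
    have hz := hs.1 x
    exact ⟨(hs.mono (by omega)).setArr (by omega), _, .store s a x y, by omega⟩
  | @seq p q s t w c d _ _ ihp ihq =>
    intro V hc hs
    simp only [Prog.constBits] at hc
    obtain ⟨ht, c', hr, hle⟩ := ihp V (by omega) hs
    -- The second program starts on numbers of up to `V + c` bits; this is why the claim is made for
    -- all `V`.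
    obtain ⟨hw, d', hr', hle'⟩ := ihq (V + c) (by omega) ht
    exact ⟨hw.mono (by omega), _, .seq hr hr', by nlinarith⟩
  | @ite_true x p q s t c hx _ ih =>
    intro V hc hs
    simp only [Prog.constBits] at hc
    have h1 := hs.1 x
    obtain ⟨ht, c', hr, hle⟩ := ih V (by omega) hs
    exact ⟨ht.mono (by omega), _, .ite_true hx hr, by nlinarith⟩
  | @ite_false x p q s t c hx _ ih =>
    intro V hc hs
    simp only [Prog.constBits] at hc
    have h1 := hs.1 x
    obtain ⟨ht, c', hr, hle⟩ := ih V (by omega) hs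
    exact ⟨ht.mono (by omega), _, .ite_false hx hr, by nlinarith⟩
  | @loop_done x p s hx =>
    intro V _ hs
    have h1 := hs.1 x
    exact ⟨hs.mono (by omega), _, .loop_done hx, by omega⟩
  | @loop_step x p s t w c d hx _ _ ihp ihq =>
    intro V hc hs
    have h1 := hs.1 x
    obtain ⟨ht, c', hr, hle⟩ := ihp V hc hs
    obtain ⟨hw, d', hr', hle'⟩ := ihq (V + c) (by simp only [Prog.constBits] at *; omega) ht
    exact ⟨hw.mono (by omega), _, .loop_step hx hr hr', by nlinarith⟩

/-! ## A language of expressions and bounded loops -/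

@[simp] theorem Memory.reg_setReg (s : Memory) (x v y : ℕ) :
    (s.setReg x v).reg y = if y = x then v else s.reg y := by
  simp [Memory.setReg, Function.update_apply]

@[simp] theorem Memory.arr_setReg (s : Memory) (x v : ℕ) : (s.setReg x v).arr = s.arr := rfl

@[simp] theorem Memory.reg_setArr (s : Memory) (a i v : ℕ) : (s.setArr a i v).reg = s.reg := rfl

@[simp] theorem Memory.arr_setArr (s : Memory) (a i v b : ℕ) :
    (s.setArr a i v).arr b = if b = a then Function.update (s.arr a) i v else s.arr b := by
  simp [Memory.setArr, Function.update_apply]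

/-- Memories that agree in all arrays and in the registers below `d`. -/
structure Agree (d : ℕ) (s t : Memory) : Prop where
  reg : ∀ x < d, s.reg x = t.reg x
  arr : s.arr = t.arr

theorem Agree.refl (d : ℕ) (s : Memory) : Agree d s s := ⟨fun _ _ => rfl, rfl⟩

theorem Agree.symm {d : ℕ} {s t : Memory} (h : Agree d s t) : Agree d t s :=
  ⟨fun x hx => (h.reg x hx).symm, h.arr.symm⟩

theorem Agree.trans {d : ℕ} {s t w : Memory} (h : Agree d s t) (h' : Agree d t w) :
    Agree d s w :=
  ⟨fun x hx => (h.reg x hx).trans (h'.reg x hx), h.arr.trans h'.arr⟩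

theorem Agree.mono {d e : ℕ} {s t : Memory} (h : Agree d s t) (he : e ≤ d) : Agree e s t :=
  ⟨fun x hx => h.reg x (hx.trans_le he), h.arr⟩

theorem Agree.setReg_of_le {d : ℕ} {s t : Memory} (h : Agree d s t) {x : ℕ} (hx : d ≤ x)
    (v : ℕ) : Agree d s (t.setReg x v) :=
  ⟨fun y hy => by rw [Memory.reg_setReg, if_neg (by omega)]; exact h.reg y hy, h.arr⟩

theorem Agree.setArr {d : ℕ} {s t : Memory} (h : Agree d s t) (a i v : ℕ) :
    Agree d (s.setArr a i v) (t.setArr a i v) :=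
  ⟨h.reg, by simp [Memory.setArr, h.arr]⟩

/-- Expressions; `mul y e` is the product of register `y` and `e`. -/
inductive Expr : Type
  | num (c : ℕ) : Expr
  | var (x : ℕ) : Expr
  | get (a : ℕ) (e : Expr) : Expr
  | add (e f : Expr) : Expr
  | sub (e f : Expr) : Expr
  | mul (y : ℕ) (e : Expr) : Expr

namespace Expr

/-- The value of an expression. -/
def eval (s : Memory) : Expr → ℕ
  | num c => c
  | var x => s.reg x
  | get a e => s.arr a (e.eval s)
  | add e f => e.eval s + f.eval s
  | sub e f => e.eval s - f.eval s
  | mul y e => s.reg y * e.eval s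

/-- The expression uses only registers below `d`, and only registers below `ro` as factors. -/
def WF (ro d : ℕ) : Expr → Bool
  | num _ => true
  | var x => x < d
  | get _ e => e.WF ro d
  | add e f => e.WF ro d && f.WF ro d
  | sub e f => e.WF ro d && f.WF ro d
  | mul y e => y < ro && y < d && e.WF ro d

/-- Code that computes an expression in register `d`, with workspace above `d`. -/
def compile : Expr → ℕ → Prog
  | num c, d => .const d c
  | var x, d => .seq (.const d 0) (.add d d x)
  | get a e, d => .seq (e.compile d) (.load d a d)
  | add e f, d => .seq (e.compile d) (.seq (f.compile (d + 1)) (.add d d (d + 1)))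
  | sub e f, d => .seq (e.compile d) (.seq (f.compile (d + 1)) (.sub d d (d + 1)))
  -- Register `d` accumulates, `d + 1` holds the summand, `d + 2` counts down from the factor, and
  -- `d + 3` holds the one to subtract. The time is linear in the value of the factor, hence the
  -- restriction of factors to registers below `ro`.
  | mul y e, d => .seq (e.compile (d + 1)) (.seq (.const d 0) (.seq (.const (d + 2) 0)
      (.seq (.add (d + 2) (d + 2) y) (.seq (.const (d + 3) 1)
        (.loop (d + 2) (.seq (.add d d (d + 1)) (.sub (d + 2) (d + 2) (d + 3))))))))

open Polynomial in
/-- A bound for the number of steps in terms of the registers used as factors. -/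
noncomputable def bound : Expr → ℕ[X]
  | num _ => 1
  | var _ => 2
  | get _ e => e.bound + 1
  | add e f => e.bound + f.bound + 1
  | sub e f => e.bound + f.bound + 1
  -- Four instructions prepare the loop, each pass takes a test, an addition and a subtraction, and
  -- one test ends it.
  | mul _ e => e.bound + 3 * X + 5

theorem eval_congr {ro d : ℕ} {s t : Memory} (h : Agree d s t) :
    ∀ e : Expr, e.WF ro d → e.eval s = e.eval t
  | num _, _ => rfl
  | var x, hw => h.reg x (by simpa [WF] using hw)
  | get a e, hw => by simp only [eval, eval_congr h e hw, h.arr]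
  | add e f, hw => by
    simp only [WF, Bool.and_eq_true] at hw
    simp only [eval, eval_congr h e hw.1, eval_congr h f hw.2]
  | sub e f, hw => by
    simp only [WF, Bool.and_eq_true] at hw
    simp only [eval, eval_congr h e hw.1, eval_congr h f hw.2]
  | mul y e, hw => by
    simp only [WF, Bool.and_eq_true, decide_eq_true_eq] at hw
    simp only [eval, eval_congr h e hw.2, h.reg y hw.1.2]

theorem WF.mono {ro d d' : ℕ} (h : d ≤ d') : ∀ e : Expr, e.WF ro d → e.WF ro d'
  | num _, _ => rfl
  | var x, hw => by simp only [WF, decide_eq_true_eq] at *; omega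
  | get a e, hw => WF.mono h e hw
  | add e f, hw => by
    simp only [WF, Bool.and_eq_true] at *
    exact ⟨WF.mono h e hw.1, WF.mono h f hw.2⟩
  | sub e f, hw => by
    simp only [WF, Bool.and_eq_true] at *
    exact ⟨WF.mono h e hw.1, WF.mono h f hw.2⟩
  | mul y e, hw => by
    simp only [WF, Bool.and_eq_true, decide_eq_true_eq] at *
    exact ⟨⟨hw.1.1, by omega⟩, WF.mono h e hw.2⟩

theorem steps_mul_loop (d : ℕ) : ∀ (k : ℕ) (s : Memory), s.reg (d + 2) = k → s.reg (d + 3) = 1 →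
    ∃ t, Steps (.loop (d + 2) (.seq (.add d d (d + 1)) (.sub (d + 2) (d + 2) (d + 3))))
      s (3 * k + 1) t ∧ Agree d s t ∧ t.reg d = s.reg d + k * s.reg (d + 1)
  | 0, s, h2, _ => ⟨s, .loop_done h2, .refl _ _, by simp⟩
  | k + 1, s, h2, h3 => by
    set s1 := s.setReg d (s.reg d + s.reg (d + 1)) with hs1
    set s2 := s1.setReg (d + 2) (s1.reg (d + 2) - s1.reg (d + 3)) with hs2
    obtain ⟨t, ht, ha, hv⟩ := steps_mul_loop d k s2 (by simp [hs2, hs1, h2, h3])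
      (by simp [hs2, hs1, h3])
    refine ⟨t, ?_, ?_, ?_⟩
    · have := Steps.loop_step (x := d + 2) (by omega)
        (.seq (.add s d d (d + 1)) (.sub s1 (d + 2) (d + 2) (d + 3))) ht
      convert this using 1
      omega
    · exact Agree.trans (((Agree.refl d s).setReg_of_le le_rfl _).setReg_of_le (by omega) _) ha
    · rw [hv]
      simp [hs2, hs1]
      ring

/-- The workspace lies above every register that the expression reads, and a first operand kept in
`d` survives the computation of the second from `d + 1` on. -/
theorem steps_compile {ro L : ℕ} : ∀ (e : Expr) (d : ℕ) (s : Memory), ro ≤ d → e.WF ro d →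
    (∀ x < ro, s.reg x ≤ L) → ∃ n t, Steps (e.compile d) s n t ∧ n ≤ e.bound.eval L ∧
      Agree d s t ∧ t.reg d = e.eval s
  | num c, d, s, _, _, _ => ⟨_, _, .const s d c, by simp [bound],
      (Agree.refl d s).setReg_of_le le_rfl _, by simp [eval]⟩
  | var x, d, s, _, hw, _ => by
    simp only [WF, decide_eq_true_eq] at hw
    refine ⟨_, _, .seq (.const s d 0) (.add _ d d x), by simp [bound],
      ((Agree.refl d s).setReg_of_le le_rfl _).setReg_of_le le_rfl _, ?_⟩
    simp [eval, hw.ne]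
  | get a e, d, s, hd, hw, hL => by
    obtain ⟨n, t, ht, hn, ha, hv⟩ := steps_compile e d s hd hw hL
    refine ⟨_, _, .seq ht (.load t d a d), by simp [bound, hn], ha.setReg_of_le le_rfl _, ?_⟩
    simp [eval, hv, ha.arr]
  | add e f, d, s, hd, hw, hL => by
    simp only [WF, Bool.and_eq_true] at hw
    obtain ⟨n, t, ht, hn, ha, hv⟩ := steps_compile e d s hd hw.1 hL
    obtain ⟨n', t', ht', hn', ha', hv'⟩ := steps_compile f (d + 1) t (by omega)
      (WF.mono (by omega) f hw.2) fun x hx => (ha.reg x (by omega)) ▸ hL x hx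
    refine ⟨_, _, .seq ht (.seq ht' (.add t' d d (d + 1))), ?_,
      (ha.trans (ha'.mono (by omega))).setReg_of_le le_rfl _, ?_⟩
    · simp [bound]; omega
    · simp [eval, ← ha'.reg d (by omega), hv, hv', eval_congr ha f hw.2]
  | sub e f, d, s, hd, hw, hL => by
    simp only [WF, Bool.and_eq_true] at hw
    obtain ⟨n, t, ht, hn, ha, hv⟩ := steps_compile e d s hd hw.1 hL
    obtain ⟨n', t', ht', hn', ha', hv'⟩ := steps_compile f (d + 1) t (by omega)
      (WF.mono (by omega) f hw.2) fun x hx => (ha.reg x (by omega)) ▸ hL x hx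
    refine ⟨_, _, .seq ht (.seq ht' (.sub t' d d (d + 1))), ?_,
      (ha.trans (ha'.mono (by omega))).setReg_of_le le_rfl _, ?_⟩
    · simp [bound]; omega
    · simp [eval, ← ha'.reg d (by omega), hv, hv', eval_congr ha f hw.2]
  | mul y e, d, s, hd, hw, hL => by
    simp only [WF, Bool.and_eq_true, decide_eq_true_eq] at hw
    obtain ⟨n, t, ht, hn, ha, hv⟩ := steps_compile e (d + 1) s (by omega)
      (WF.mono (by omega) e hw.2) hL
    set t1 := t.setReg d 0 with ht1
    set t2 := t1.setReg (d + 2) 0 with ht2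
    set t3 := t2.setReg (d + 2) (t2.reg (d + 2) + t2.reg y) with ht3
    set t4 := t3.setReg (d + 3) 1 with ht4
    have hA : Agree d s t4 := ((((ha.mono (by omega)).setReg_of_le (by omega) _).setReg_of_le
      (by omega) _).setReg_of_le (by omega) _).setReg_of_le (by omega) _
    have hy : t4.reg (d + 2) = s.reg y := by
      have h1 : y ≠ d := by omega
      have h2 : y ≠ d + 2 := by omega
      simp [ht4, ht3, ht2, ht1, h1, h2, ← ha.reg y (by omega)]
    obtain ⟨w, hw', haw, hvw⟩ := steps_mul_loop d (s.reg y) t4 hy (by simp [ht4])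
    refine ⟨_, w, .seq ht (.seq (.const _ _ _) (.seq (.const _ _ _) (.seq (.add _ _ _ _)
      (.seq (.const _ _ _) hw')))), ?_, hA.trans haw, ?_⟩
    · have := hL y hw.1.1
      simp [bound]; omega
    · simp [hvw, ht4, ht3, ht2, ht1, eval, hv]

end Expr

/-- Commands; `loop x y c` runs `c` for all values of `x` below that of `y`. -/
inductive Cmd : Type
  | skip : Cmd
  | assign (x : ℕ) (e : Expr) : Cmd
  | store (a : ℕ) (e f : Expr) : Cmd
  | seq (c d : Cmd) : Cmd
  | ite (e : Expr) (c d : Cmd) : Cmd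
  | loop (x y : ℕ) (c : Cmd) : Cmd

/-- Apply `f 0`, …, `f (n - 1)` in this order. -/
def iter {α : Type*} (f : ℕ → α → α) : ℕ → α → α
  | 0, s => s
  | n + 1, s => f n (iter f n s)

theorem iter_induction {α : Type*} {f : ℕ → α → α} {n : ℕ} {s : α} (P : ℕ → α → Prop)
    (h0 : P 0 s) (hs : ∀ i < n, ∀ t, P i t → P (i + 1) (f i t)) : P n (iter f n s) := by
  suffices h : ∀ k ≤ n, P k (iter f k s) from h n le_rfl
  intro k hk
  induction k with
  | zero => exact h0
  | succ k ih => exact hs k (by omega) _ (ih (by omega))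

namespace Cmd

/-- The effect of a command. -/
def eval : Cmd → Memory → Memory
  | skip, s => s
  | assign x e, s => s.setReg x (e.eval s)
  | store a e f, s => s.setArr a (e.eval s) (f.eval s)
  | seq c d, s => d.eval (c.eval s)
  | ite e c d, s => if e.eval s ≠ 0 then c.eval s else d.eval s
  | loop x y c, s => iter (fun i t => c.eval (t.setReg x i)) (s.reg y) s

/-- The command uses only registers below `d`, it does not change those below `ro`, and only these
bound loops and serve as factors. -/
def WF (ro d : ℕ) : Cmd → Bool
  | skip => true
  | assign x e => ro ≤ x && x < d && e.WF ro d
  | store _ e f => e.WF ro d && f.WF ro d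
  | seq c c' => c.WF ro d && c'.WF ro d
  | ite e c c' => e.WF ro d && c.WF ro d && c'.WF ro d
  | loop x y c => ro ≤ x && x < d && y < ro && c.WF ro d

/-- Code for a command, with workspace from register `d` on. -/
def compile : Cmd → ℕ → Prog
  | skip, _ => .skip
  | assign x e, d => .seq (e.compile d) (.seq (.const x 0) (.add x x d))
  | store a e f, d => .seq (e.compile d) (.seq (f.compile (d + 1)) (.store a d (d + 1)))
  | seq c c', d => .seq (c.compile d) (c'.compile d)
  | ite e c c', d => .seq (e.compile d) (.ite d (c.compile d) (c'.compile d))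
  -- Register `d` counts down, `d + 1` holds the index, `d + 2` the constant one. The index is
  -- copied to `x` in each pass, so assignments to `x` in the body do not disturb the iteration.
  | loop x y c, d => .seq (.const d 0) (.seq (.add d d y) (.seq (.const (d + 1) 0)
      (.seq (.const (d + 2) 1) (.loop d (.seq (.const x 0) (.seq (.add x x (d + 1))
        (.seq (c.compile (d + 3)) (.seq (.add (d + 1) (d + 1) (d + 2))
          (.sub d d (d + 2))))))))))

open Polynomial in
/-- A bound for the number of steps in terms of the read-only registers. -/
noncomputable def bound : Cmd → ℕ[X]
  | skip => 1
  | assign _ e => e.bound + 2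
  | store _ e f => e.bound + f.bound + 1
  | seq c d => c.bound + d.bound
  | ite e c d => e.bound + c.bound + d.bound + 1
  | loop _ _ c => X * (c.bound + 5) + 5

/-- This makes a bound `L` on the read-only registers, valid at the start, available at every later
loop and product. -/
theorem reg_eval_of_lt {ro d : ℕ} : ∀ (c : Cmd) (s : Memory), c.WF ro d → ∀ z < ro,
    (c.eval s).reg z = s.reg z
  | skip, _, _, _, _ => rfl
  | assign x e, s, hw, z, hz => by
    simp only [WF, Bool.and_eq_true, decide_eq_true_eq] at hw
    simp [eval, show z ≠ x by omega]
  | store _ _ _, _, _, _, _ => rfl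
  | seq c c', s, hw, z, hz => by
    simp only [WF, Bool.and_eq_true] at hw
    rw [eval, reg_eval_of_lt c' _ hw.2 z hz, reg_eval_of_lt c _ hw.1 z hz]
  | ite e c c', s, hw, z, hz => by
    simp only [WF, Bool.and_eq_true] at hw
    rw [eval]
    split_ifs
    · exact reg_eval_of_lt c _ hw.1.2 z hz
    · exact reg_eval_of_lt c' _ hw.2 z hz
  | loop x y c, s, hw, z, hz => by
    simp only [WF, Bool.and_eq_true, decide_eq_true_eq] at hw
    refine iter_induction (fun _ (t : Memory) => t.reg z = s.reg z) rfl fun i _ t ht => ?_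
    rw [reg_eval_of_lt c _ hw.2 z hz, Memory.reg_setReg, if_neg (by omega), ht]

/-- Here `s` is the memory of the machine and `s'` that of the semantics; they are compared below
`b` only. The registers from `b` to `d` hold the counters of enclosing loops, and the last conjunct
says that these survive. -/
theorem steps_compile {ro b L : ℕ} : ∀ (c : Cmd) (d : ℕ) (s s' : Memory), ro ≤ b → b ≤ d →
    c.WF ro b → (∀ x < ro, s'.reg x ≤ L) → Agree b s s' →
      ∃ n t, Steps (c.compile d) s n t ∧ n ≤ c.bound.eval L ∧ Agree b t (c.eval s') ∧
        ∀ z, b ≤ z → z < d → t.reg z = s.reg z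
  | skip, d, s, s', _, _, _, _, hs => ⟨_, _, .skip s, by simp [bound], hs, fun _ _ _ => rfl⟩
  | assign x e, d, s, s', hb, hd, hw, hL, hs => by
    simp only [WF, Bool.and_eq_true, decide_eq_true_eq] at hw
    obtain ⟨n, t, ht, hn, ha, hv⟩ := e.steps_compile d s (by omega) (Expr.WF.mono hd e hw.2)
      fun x hx => (hs.reg x (by omega)) ▸ hL x hx
    have h1 : d ≠ x := by omega
    refine ⟨_, _, .seq ht (.seq (.const _ _ _) (.add _ _ _ _)), ?_, ?_, fun z hz hz' => ?_⟩
    · simp [bound, hn]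
    · refine ⟨fun z hz => ?_, ?_⟩
      · by_cases hzx : z = x
        · simp [hzx, h1, hv, eval, Expr.eval_congr hs e hw.2]
        · simp [hzx, eval, ← ha.reg z (by omega), hs.reg z hz]
      · simp [eval, ← ha.arr, hs.arr]
    · simp [show z ≠ x by omega, ha.reg z hz']
  | store a e f, d, s, s', hb, hd, hw, hL, hs => by
    simp only [WF, Bool.and_eq_true] at hw
    have hL' : ∀ x < ro, s.reg x ≤ L := fun x hx => (hs.reg x (by omega)) ▸ hL x hx
    have hwf := Expr.WF.mono hd f hw.2
    obtain ⟨n, t, ht, hn, ha, hv⟩ := e.steps_compile d s (by omega) (Expr.WF.mono hd e hw.1) hL'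
    obtain ⟨n', t', ht', hn', ha', hv'⟩ := f.steps_compile (d + 1) t (by omega)
      (Expr.WF.mono (by omega) f hwf) fun x hx => (ha.reg x (by omega)) ▸ hL' x hx
    have hA := ha.trans (ha'.mono (by omega))
    refine ⟨_, _, .seq ht (.seq ht' (.store _ _ _ _)), ?_, ?_, fun z hz hz' => (hA.reg z hz').symm⟩
    · simp [bound]; omega
    · rw [hv', ← ha'.reg d (by omega), hv, ← Expr.eval_congr ha f hwf,
        Expr.eval_congr hs f hw.2, Expr.eval_congr hs e hw.1, eval]
      exact ((hA.mono hd).symm.trans hs).setArr _ _ _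
  | seq c c', d, s, s', hb, hd, hw, hL, hs => by
    simp only [WF, Bool.and_eq_true] at hw
    obtain ⟨n, t, ht, hn, ha, hz⟩ := steps_compile c d s s' hb hd hw.1 hL hs
    obtain ⟨n', t', ht', hn', ha', hz'⟩ := steps_compile c' d t (c.eval s') hb hd hw.2
      (fun x hx => (reg_eval_of_lt c s' hw.1 x hx).le.trans (hL x hx)) ha
    exact ⟨_, _, .seq ht ht', by simp [bound]; omega, ha',
      fun z h h' => (hz' z h h').trans (hz z h h')⟩
  | ite e c c', d, s, s', hb, hd, hw, hL, hs => by
    simp only [WF, Bool.and_eq_true] at hw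
    obtain ⟨n, t, ht, hn, ha, hv⟩ := e.steps_compile d s (by omega) (Expr.WF.mono hd e hw.1.1)
      fun x hx => (hs.reg x (by omega)) ▸ hL x hx
    rw [Expr.eval_congr hs e hw.1.1] at hv
    by_cases h : e.eval s' = 0
    · obtain ⟨n', t', ht', hn', ha', hz⟩ := steps_compile c' d t s' hb hd hw.2 hL
        ((ha.mono hd).symm.trans hs)
      exact ⟨_, _, .seq ht (.ite_false (by omega) ht'), by simp [bound]; omega,
        by simpa [eval, h] using ha', fun z h h' => (hz z h h').trans (ha.reg z h').symm⟩
    · obtain ⟨n', t', ht', hn', ha', hz⟩ := steps_compile c d t s' hb hd hw.1.2 hL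
        ((ha.mono hd).symm.trans hs)
      exact ⟨_, _, .seq ht (.ite_true (by omega) ht'), by simp [bound]; omega,
        by simpa [eval, h] using ha', fun z h h' => (hz z h h').trans (ha.reg z h').symm⟩
  | loop x y c, d, s, s', hb, hd, hw, hL, hs => by
    simp only [WF, Bool.and_eq_true, decide_eq_true_eq] at hw
    obtain ⟨⟨⟨hx, hxd⟩, hy⟩, hc⟩ := hw
    have e0 : d ≠ x := by omega
    have e1 : d + 1 ≠ x := by omega
    have e2 : d + 2 ≠ x := by omega
    -- With `k` passes to go and `i` done, `s'` is tied to the start `w` of the loop only by an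
    -- equation, so the induction on `k` may change it from pass to pass.
    have key : ∀ (k i : ℕ) (s s' : Memory), (∀ x < ro, s'.reg x ≤ L) → Agree b s s' →
        s.reg d = k → s.reg (d + 1) = i → s.reg (d + 2) = 1 → ∃ n t,
        Steps (.loop d (.seq (.const x 0) (.seq (.add x x (d + 1))
          (.seq (c.compile (d + 3)) (.seq (.add (d + 1) (d + 1) (d + 2))
          (.sub d d (d + 2))))))) s n t ∧ n ≤ k * (c.bound.eval L + 5) + 1 ∧
        (∀ w, s' = iter (fun i t => c.eval (t.setReg x i)) i w →
          Agree b t (iter (fun i t => c.eval (t.setReg x i)) (i + k) w)) ∧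
        ∀ z, b ≤ z → z < d → t.reg z = s.reg z := by
      intro k
      induction k with
      | zero =>
        intro i s s' _ hs h0 _ _
        exact ⟨_, _, .loop_done h0, by omega, fun w hw => hw ▸ hs, fun _ _ _ => rfl⟩
      | succ k ih =>
        intro i s s' hL hs h0 h1 h2
        set s1 := s.setReg x 0 with hs1
        set s2 := s1.setReg x (s1.reg x + s1.reg (d + 1)) with hs2
        have hA : Agree b s2 (s'.setReg x i) := by
          refine ⟨fun z hz => ?_, hs.arr⟩
          by_cases hzx : z = x
          · simp [hzx, hs2, hs1, e1, h1]
          · simp [hzx, hs2, hs1, hs.reg z hz]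
        have hL2 : ∀ z < ro, (s'.setReg x i).reg z ≤ L := fun z hz => by
          rw [Memory.reg_setReg, if_neg (by omega)]; exact hL z hz
        obtain ⟨n, t, ht, hn, ha, hz⟩ := steps_compile c (d + 3) s2 (s'.setReg x i) hb (by omega)
          hc hL2 hA
        have r0 : t.reg d = k + 1 := by rw [hz d hd (by omega)]; simp [hs2, hs1, e0, h0]
        have r1 : t.reg (d + 1) = i := by
          rw [hz (d + 1) (by omega) (by omega)]; simp [hs2, hs1, e1, h1]
        have r2 : t.reg (d + 2) = 1 := by
          rw [hz (d + 2) (by omega) (by omega)]; simp [hs2, hs1, e2, h2]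
        set t1 := t.setReg (d + 1) (t.reg (d + 1) + t.reg (d + 2)) with ht1
        set t2 := t1.setReg d (t1.reg d - t1.reg (d + 2)) with ht2
        obtain ⟨n', w, hw, hn', ha', hz'⟩ := ih (i + 1) t2 (c.eval (s'.setReg x i))
          (fun z hz => (reg_eval_of_lt c _ hc z hz).le.trans (hL2 z hz))
          ((ha.symm.setReg_of_le (by omega) _).setReg_of_le hd _).symm
          (by simp [ht2, ht1, r0, r2]) (by simp [ht2, ht1, r1, r2]) (by simp [ht2, ht1, r2])
        refine ⟨_, w, .loop_step (by omega) (.seq (.const _ _ _) (.seq (.add _ _ _ _) (.seq ht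
          (.seq (.add _ _ _ _) (.sub _ _ _ _))))) hw, by linarith, fun w' hw' => ?_,
          fun z h h' => ?_⟩
        · have := ha' w' (by rw [iter, ← hw'])
          rwa [Nat.add_right_comm] at this
        · rw [hz' z h h']
          simp only [ht2, ht1, Memory.reg_setReg]
          rw [if_neg (by omega), if_neg (by omega), hz z h (by omega)]
          simp [hs2, hs1, show z ≠ x by omega]
    set s1 := s.setReg d 0 with hs1
    set s2 := s1.setReg d (s1.reg d + s1.reg y) with hs2
    set s3 := s2.setReg (d + 1) 0 with hs3
    set s4 := s3.setReg (d + 2) 1 with hs4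
    have hy0 : y ≠ d := by omega
    obtain ⟨n, t, ht, hn, ha, hz⟩ := key (s'.reg y) 0 s4 s' hL
      ((((hs.symm.setReg_of_le (by omega) _).setReg_of_le (by omega) _).setReg_of_le
        (by omega) _).setReg_of_le (by omega) _).symm
      (by simp [hs4, hs3, hs2, hs1, hy0, hs.reg y (by omega)]) (by simp [hs4, hs3])
      (by simp [hs4])
    refine ⟨_, t, .seq (.const _ _ _) (.seq (.add _ _ _ _) (.seq (.const _ _ _)
      (.seq (.const _ _ _) ht))), ?_, ?_, fun z h h' => ?_⟩
    · have := Nat.mul_le_mul_right (c.bound.eval L + 5) (hL y hy)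
      simp [bound]; omega
    · simpa [eval] using ha s' rfl
    · rw [hz z h h']
      simp [hs4, hs3, hs2, hs1, show z ≠ d by omega, show z ≠ d + 1 by omega,
        show z ≠ d + 2 by omega]

/-- The command may assign to register `z`. -/
def ModReg (z : ℕ) : Cmd → Bool
  | skip => false
  | assign x _ => z = x
  | store _ _ _ => false
  | seq c d => c.ModReg z || d.ModReg z
  | ite _ c d => c.ModReg z || d.ModReg z
  | loop x _ c => z = x || c.ModReg z

/-- The command may store to array `a`. -/
def ModArr (a : ℕ) : Cmd → Bool
  | skip => false
  | assign _ _ => false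
  | store b _ _ => a = b
  | seq c d => c.ModArr a || d.ModArr a
  | ite _ c d => c.ModArr a || d.ModArr a
  | loop _ _ c => c.ModArr a

/-- A frame rule: for a concrete command the hypothesis holds by computation, so `rfl` proves it. -/
theorem reg_eval_of_not_modReg {z : ℕ} : ∀ (c : Cmd) (s : Memory), c.ModReg z = false →
    (c.eval s).reg z = s.reg z
  | skip, _, _ => rfl
  | assign x e, s, h => by
    simp only [ModReg, decide_eq_false_iff_not] at h
    simp [eval, h]
  | store _ _ _, _, _ => rfl
  | seq c c', s, h => by
    simp only [ModReg, Bool.or_eq_false_iff] at h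
    rw [eval, reg_eval_of_not_modReg c' _ h.2, reg_eval_of_not_modReg c _ h.1]
  | ite e c c', s, h => by
    simp only [ModReg, Bool.or_eq_false_iff] at h
    rw [eval]
    split_ifs
    · exact reg_eval_of_not_modReg c _ h.1
    · exact reg_eval_of_not_modReg c' _ h.2
  | loop x y c, s, h => by
    simp only [ModReg, Bool.or_eq_false_iff, decide_eq_false_iff_not] at h
    refine iter_induction (fun _ (t : Memory) => t.reg z = s.reg z) rfl fun i _ t ht => ?_
    rw [reg_eval_of_not_modReg c _ h.2, Memory.reg_setReg, if_neg h.1, ht]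

theorem arr_eval_of_not_modArr {a : ℕ} : ∀ (c : Cmd) (s : Memory), c.ModArr a = false →
    (c.eval s).arr a = s.arr a
  | skip, _, _ => rfl
  | assign _ _, _, _ => rfl
  | store b e f, s, h => by
    simp only [ModArr, decide_eq_false_iff_not] at h
    simp [eval, h]
  | seq c c', s, h => by
    simp only [ModArr, Bool.or_eq_false_iff] at h
    rw [eval, arr_eval_of_not_modArr c' _ h.2, arr_eval_of_not_modArr c _ h.1]
  | ite e c c', s, h => by
    simp only [ModArr, Bool.or_eq_false_iff] at h
    rw [eval]
    split_ifs
    · exact arr_eval_of_not_modArr c _ h.1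
    · exact arr_eval_of_not_modArr c' _ h.2
  | loop x y c, s, h => by
    simp only [ModArr] at h
    refine iter_induction (fun _ (t : Memory) => t.arr a = s.arr a) rfl fun i _ t ht => ?_
    rw [arr_eval_of_not_modArr c _ h, Memory.arr_setReg, ht]

end Cmd

/-! ### From commands to polynomial time on input words -/

theorem length_le_inputSize (w : List ℕ) : w.length ≤ inputSize w := by
  induction w with
  | nil => simp
  | cons a w ih => simp only [inputSize, List.map_cons, List.sum_cons, List.length_cons] at *; omega

theorem size_getD_le_inputSize (w : List ℕ) (i : ℕ) : (w.getD i 0).size ≤ inputSize w := by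
  induction w generalizing i with
  | nil => simp
  | cons a w ih =>
    simp only [inputSize, List.map_cons, List.sum_cons] at *
    cases i with
    | zero => simp; omega
    | succ i => have := ih i; simp only [List.getD_cons_succ]; omega

theorem bitBound_init (w : List ℕ) : (init w).BitBound (inputSize w) := by
  refine ⟨fun x => ?_, fun a i => ?_⟩
  · by_cases hx : x = 0
    · simp only [init, hx, if_true]
      exact (Nat.size_le.2 Nat.lt_two_pow_self).trans (length_le_inputSize w)
    · simp [init, hx]
  · by_cases ha : a = 0
    · simpa only [init, ha, if_true] using size_getD_le_inputSize w i
    · simp [init, ha]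

/-- Three commands in sequence, a preparation that may set the loop bounds, a main part that may
not, and one without loops, solve a decision problem in polynomial time. -/
theorem solvableInPolyTime_of_cmd {α : Type*} {enc : α → List ℕ} {P : α → Prop}
    (c₁ c₂ c₃ : Cmd) (ro b : ℕ) (hro : ro ≤ b) (h₁ : c₁.WF 0 b) (h₂ : c₂.WF ro b)
    (h₃ : c₃.WF 0 b)
    (hL : ∀ x, ∀ z < ro, (c₁.eval (init (enc x))).reg z ≤ inputSize (enc x))
    (hyes : ∀ x, P x → (c₃.eval (c₂.eval (c₁.eval (init (enc x))))).reg 0 = 1)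
    (hno : ∀ x, ¬ P x → (c₃.eval (c₂.eval (c₁.eval (init (enc x))))).reg 0 = 0)
    (hb : 0 < b) : SolvableInPolyTime enc P := by
  set p : Prog := .seq (c₁.compile b) (.seq (c₂.compile b) (c₃.compile b)) with hp
  set Q : Polynomial ℕ := c₁.bound + (c₂.bound + c₃.bound) with hQ
  refine ⟨p, Q * (1 + 2 * (Polynomial.X + Polynomial.C p.constBits + Q)), fun x => ?_⟩
  set L := inputSize (enc x) with hLdef
  -- Well-formedness for `ro = 0` excludes loops and products, so for `c₁` and `c₃` the bound on
  -- read-only registers is vacuous.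
  obtain ⟨n₁, t₁, ht₁, hn₁, ha₁, -⟩ := c₁.steps_compile (L := L) b _ _ (Nat.zero_le _) le_rfl h₁
    (by simp) (Agree.refl b (init (enc x)))
  obtain ⟨n₂, t₂, ht₂, hn₂, ha₂, -⟩ := c₂.steps_compile (L := L) b _ _ hro le_rfl h₂ (hL x) ha₁
  obtain ⟨n₃, t₃, ht₃, hn₃, ha₃, -⟩ := c₃.steps_compile (L := L) b _ _ (Nat.zero_le _) le_rfl h₃
    (by simp) ha₂
  -- The initial bit bound has to cover the numbers of the input and the constants of the program.
  obtain ⟨-, c, hc, hle⟩ := (Steps.seq ht₁ (.seq ht₂ ht₃)).run (L + p.constBits)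
    (Nat.le_add_left _ _) ((bitBound_init (enc x)).mono (Nat.le_add_right _ _))
  have hn : n₁ + (n₂ + n₃) ≤ Q.eval L := by simp only [hQ, Polynomial.eval_add]; omega
  refine ⟨c, t₃, hc, hle.trans ?_, fun h => ?_, fun h => ?_⟩
  · simp only [Polynomial.eval_mul, Polynomial.eval_add, Polynomial.eval_one, Polynomial.eval_X,
      Polynomial.eval_C, Polynomial.eval_ofNat]
    gcongr
  · rw [ha₃.reg 0 hb, hyes x h]
  · rw [ha₃.reg 0 hb, hno x h]

end RAM

/-! ## Bipartite matching by an auction -/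

namespace Auction

/-- Every `b < N` with `low b` can be given its own `a < N` with `h b a`. -/
def Perfect (N : ℕ) (low : ℕ → Prop) (h : ℕ → ℕ → Prop) : Prop :=
  ∃ f : ℕ → ℕ, (∀ b < N, low b → f b < N ∧ h b (f b)) ∧
    ∀ b < N, ∀ b' < N, low b → low b' → f b = f b' → b = b'

/-- The invariant of the auction: `owner a` is zero or one more than the bidder who holds `a`, and
every bidder holds an object that was one of the cheapest to them. -/
structure Inv (N : ℕ) (low : ℕ → Prop) (h : ℕ → ℕ → Prop) (owner price : ℕ → ℕ) : Prop where
  owner_spec : ∀ a b, owner a = b + 1 → a < N ∧ b < N ∧ low b ∧ h b a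
  owner_inj : ∀ a a', owner a = owner a' → owner a ≠ 0 → a = a'
  slack : ∀ a b, owner a = b + 1 → ∀ a' < N, h b a' → price a ≤ price a' + 1
  free : ∀ a, owner a = 0 → price a = 0
  high : (∃ a < N, N < price a) → ¬ Perfect N low h

variable {N : ℕ} {low : ℕ → Prop} {h : ℕ → ℕ → Prop} {owner price : ℕ → ℕ}

theorem inv_zero : Inv N low h (fun _ => 0) (fun _ => 0) where
  owner_spec := by simp
  owner_inj := by simp
  slack := by simp
  free := by simp
  high := by simp

/-- If all objects that a bidder without object wants cost at least `N`, then some price below that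
is not taken, and the bidders of higher objects violate Hall's condition. -/
theorem Inv.not_perfect (hI : Inv N low h owner price) {b : ℕ} (hb : b < N) (hlow : low b)
    (hun : ∀ a < N, owner a ≠ b + 1) (hhigh : ∀ a < N, h b a → N ≤ price a) :
    ¬ Perfect N low h := by
  classical
  rintro ⟨f, hf, hinj⟩
  have hbidder : ∀ a, price a ≠ 0 → ∃ b', owner a = b' + 1 ∧ b' < N ∧ a < N ∧ b' ≠ b ∧ low b' ∧
      h b' a := by
    intro a ha
    obtain ⟨b', hb'⟩ := Nat.exists_eq_succ_of_ne_zero (fun h0 => ha (hI.free a h0))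
    obtain ⟨h1, h2, h3, h4⟩ := hI.owner_spec a b' hb'
    exact ⟨b', hb', h2, h1, fun e => hun a h1 (e ▸ hb'), h3, h4⟩
  -- a price that is not taken
  obtain ⟨j, hj, hjN, hjp⟩ : ∃ j, 1 ≤ j ∧ j ≤ N ∧ ∀ a < N, price a ≠ j := by
    -- If all prices from `1` to `N` occurred, the objects at these prices would have `N` distinct
    -- owners, all different from `b`, among only `N - 1` candidates.
    by_contra! hcon
    choose! g hg using hcon
    have hcard : (Finset.Icc 1 N).card ≤ ((Finset.range N).erase b).card := by
      refine Finset.card_le_card_of_injOn (fun j => owner (g j) - 1) ?_ ?_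
      · intro j hj
        simp only [Finset.coe_Icc, Set.mem_Icc] at hj
        obtain ⟨b', h1, h2, -, h3, -⟩ := hbidder (g j) (by rw [(hg j hj.1 hj.2).2]; omega)
        simp [h1, h2, h3]
      · intro j hj j' hj' e
        simp only [Finset.coe_Icc, Set.mem_Icc] at hj hj'
        obtain ⟨b', h1, -⟩ := hbidder (g j) (by rw [(hg j hj.1 hj.2).2]; omega)
        obtain ⟨b'', h1', -⟩ := hbidder (g j') (by rw [(hg j' hj'.1 hj'.2).2]; omega)
        simp only [h1, h1'] at e
        have := hI.owner_inj (g j) (g j') (by omega) (by omega)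
        rw [← (hg j hj.1 hj.2).2, ← (hg j' hj'.1 hj'.2).2, this]
    rw [Finset.card_erase_of_mem (by simpa using hb)] at hcard
    simp at hcard
    omega
  set S := (Finset.range N).filter fun b' => ∃ a, owner a = b' + 1 ∧ j < price a with hS
  set U := (Finset.range N).filter fun a => j < price a with hU
  have hbS : b ∉ S := by
    simp only [hS, Finset.mem_filter, not_and, not_exists]
    intro _ a
    exact fun e => absurd e (hun a (hI.owner_spec a b e).1)
  -- By `slack`, a bidder in `S` wants only objects of price at least `j`, hence above `j` as `j` is
  -- not taken; for `b` the same follows from `hhigh`. So `f` maps `insert b S` into `U`.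
  have hup : (insert b S).card ≤ U.card := by
    refine Finset.card_le_card_of_injOn f ?_ ?_
    · intro b' hb'
      rw [Finset.mem_coe, Finset.mem_insert] at hb'
      simp only [hU, Finset.coe_filter, Finset.mem_range, Set.mem_ofPred_eq]
      rcases hb' with rfl | hb'
      · have h1 := hf b' hb hlow
        have h2 := hhigh _ h1.1 h1.2
        have h3 := hjp _ h1.1
        exact ⟨h1.1, by omega⟩
      · simp only [hS, Finset.mem_filter] at hb'
        obtain ⟨-, a, ha, hja⟩ := hb'
        obtain ⟨-, h2, h3, -⟩ := hI.owner_spec a b' ha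
        have h4 := hf b' h2 h3
        have h5 := hI.slack a b' ha _ h4.1 h4.2
        have h6 := hjp _ h4.1
        exact ⟨h4.1, by omega⟩
    · have hmem : ∀ b' ∈ insert b S, b' < N ∧ low b' := by
        intro b' hb'
        rw [Finset.mem_insert] at hb'
        rcases hb' with rfl | hb'
        · exact ⟨hb, hlow⟩
        · simp only [hS, Finset.mem_filter] at hb'
          obtain ⟨-, a, ha, -⟩ := hb'
          have := hI.owner_spec a b' ha
          exact ⟨this.2.1, this.2.2.1⟩
      intro b₁ h₁ b₂ h₂ e
      exact hinj _ (hmem _ h₁).1 _ (hmem _ h₂).1 (hmem _ h₁).2 (hmem _ h₂).2 e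
  -- Objects in `U` have positive price, hence owners by `free`, and these owners are in `S`.
  have hdown : U.card ≤ S.card := by
    refine Finset.card_le_card_of_injOn (fun a => owner a - 1) ?_ ?_
    · intro a ha
      simp only [hU, Finset.coe_filter, Finset.mem_range, Set.mem_ofPred_eq] at ha
      obtain ⟨b', h1, h2, -⟩ := hbidder a (by omega)
      simp only [hS, Finset.coe_filter, Finset.mem_range, Set.mem_ofPred_eq, h1,
        Nat.add_sub_cancel]
      exact ⟨h2, a, h1, ha.2⟩
    · intro a ha a' ha' e
      simp only [hU, Finset.coe_filter, Finset.mem_range, Set.mem_ofPred_eq] at ha ha'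
      obtain ⟨b', h1, -⟩ := hbidder a (by omega)
      obtain ⟨b'', h1', -⟩ := hbidder a' (by omega)
      simp only [h1, h1'] at e
      exact hI.owner_inj a a' (by omega) (by omega)
  rw [Finset.card_insert_of_notMem hbS] at hup
  omega

/-- A bidder without object takes one of the cheapest objects they want and raises its price. -/
theorem Inv.bid (hI : Inv N low h owner price) {a b : ℕ} (ha : a < N) (hb : b < N) (hlow : low b)
    (hun : ∀ a < N, owner a ≠ b + 1) (hba : h b a)
    (hmin : ∀ a' < N, h b a' → price a ≤ price a') :
    Inv N low h (Function.update owner a (b + 1)) (Function.update price a (price a + 1)) := by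
  have hle : ∀ x, price x ≤ Function.update price a (price a + 1) x := by
    intro x
    by_cases hx : x = a
    · subst hx; simp
    · simp [hx]
  refine ⟨?_, ?_, ?_, ?_, ?_⟩
  · intro a' b' e
    by_cases hx : a' = a
    · subst hx
      simp only [Function.update_self, Nat.add_right_cancel_iff] at e
      subst e
      exact ⟨ha, hb, hlow, hba⟩
    · exact hI.owner_spec a' b' (by simpa [hx] using e)
  · have hun' : ∀ x, owner x ≠ b + 1 := fun x e => hun x (hI.owner_spec x b e).1 e
    intro x y e hne
    by_cases hx : x = a <;> by_cases hy : y = a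
    · rw [hx, hy]
    · subst hx
      simp only [Function.update_self, Function.update_of_ne hy] at e
      exact absurd e.symm (hun' y)
    · subst hy
      simp only [Function.update_self, Function.update_of_ne hx] at e
      exact absurd e (hun' x)
    · simp only [Function.update_of_ne hx, Function.update_of_ne hy] at e hne
      exact hI.owner_inj x y e hne
  · intro x b' e a' ha' hb'
    -- Prices never fall, so it suffices to compare with the old price of `a'`.
    refine le_trans ?_ (Nat.add_le_add_right (hle a') 1)
    by_cases hx : x = a
    · subst hx
      simp only [Function.update_self, Nat.add_right_cancel_iff] at e ⊢
      subst e
      exact Nat.add_le_add_right (hmin a' ha' hb') 1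
    · simp only [Function.update_of_ne hx] at e ⊢
      exact hI.slack x b' e a' ha' hb'
  · intro x e
    by_cases hx : x = a
    · subst hx; simp at e
    · simp only [Function.update_of_ne hx] at e ⊢
      exact hI.free x e
  · rintro ⟨x, hx, hxN⟩
    by_cases hxa : x = a
    · subst hxa
      simp only [Function.update_self] at hxN
      -- A new price above `N` means an old one of at least `N`, and `a` was a cheapest object for
      -- `b`; the old state already excludes a perfect assignment.
      exact hI.not_perfect hb hlow hun fun a' ha' hb' => by
        have := hmin a' ha' hb'; omega
    · simp only [Function.update_of_ne hxa] at hxN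
      exact hI.high ⟨x, hx, hxN⟩

theorem sum_update_price {a : ℕ} (ha : a < N) :
    ∑ x ∈ Finset.range N, Function.update price a (price a + 1) x
      = (∑ x ∈ Finset.range N, price x) + 1 := by
  rw [Finset.sum_update_of_mem (by simpa using ha), ← Finset.add_sum_erase _ _
    (Finset.mem_range.2 ha), Finset.sdiff_singleton_eq_erase]
  omega

/-- If all bidders have objects then the assignment is perfect. -/
theorem Inv.perfect (hI : Inv N low h owner price)
    (hall : ∀ b < N, low b → ∃ a < N, owner a = b + 1) : Perfect N low h := by
  choose! g hg using hall
  refine ⟨g, fun b hb hl => ?_, fun b hb b' hb' hl hl' e => ?_⟩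
  · obtain ⟨h1, h2⟩ := hg b hb hl
    exact ⟨h1, (hI.owner_spec _ _ h2).2.2.2⟩
  · have h1 := (hg b hb hl).2
    have h2 := (hg b' hb' hl').2
    rw [e, h2] at h1
    omega

/-- If the prices sum to more than `N * N` then there is no perfect assignment. -/
theorem Inv.not_perfect_of_sum (hI : Inv N low h owner price)
    (hsum : N * N < ∑ x ∈ Finset.range N, price x) : ¬ Perfect N low h := by
  refine hI.high ?_
  by_contra! hcon
  have := Finset.sum_le_card_nsmul (Finset.range N) price N fun a ha =>
    hcon a (Finset.mem_range.1 ha)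
  rw [Finset.card_range, smul_eq_mul] at this
  exact absurd hsum this.not_gt

end Auction

/-! ## The program -/

namespace RAM

theorem Cmd.eval_loop_induction {x y : ℕ} {c : Cmd} {s : Memory} (P : ℕ → Memory → Prop)
    (h0 : P 0 s) (hs : ∀ i < s.reg y, ∀ t, P i t → P (i + 1) (c.eval (t.setReg x i))) :
    P (s.reg y) ((Cmd.loop x y c).eval s) :=
  iter_induction P h0 hs

end RAM

namespace Sharing

open RAM Expr Cmd

/-- The numbers that describe an instance. -/
structure Table where
  N : ℕ
  m : ℕ
  k : ℕ
  adj : ℕ → ℕ → ℕ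
  al : ℕ → ℕ → ℕ
  ut : ℕ → ℕ → ℕ

namespace Table

variable (D : Table)

/-- The initial value of the bundle of `b`. -/
def val (b : ℕ) : ℕ := ∑ r ∈ Finset.range D.m, if D.al b r ≠ 0 then D.ut b r else 0

/-- Agent `b` is below the target. -/
def Low (b : ℕ) : Prop := D.val b < D.k

/-- Agent `a` can help agent `b`. -/
def Help (b a : ℕ) : Prop :=
  D.val b < D.k ∧ D.k ≤ D.val a ∧ D.adj a b ≠ 0 ∧
    ∃ r < D.m, D.al a r ≠ 0 ∧ D.k ≤ D.val b + D.ut b r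

/-- The memory contains the data in registers `1`, `2`, `3` and array `0`. -/
structure Stored (s : Memory) : Prop where
  N : s.reg 1 = D.N
  m : s.reg 2 = D.m
  k : s.reg 3 = D.k
  adj : ∀ a < D.N, ∀ b < D.N, s.arr 0 (3 + (D.N * a + b)) = D.adj a b
  al : ∀ a < D.N, ∀ r < D.m, s.arr 0 (3 + D.N * D.N + (D.m * a + r)) = D.al a r
  ut : ∀ a < D.N, ∀ r < D.m, s.arr 0 (3 + D.N * D.N + D.N * D.m + (D.m * a + r)) = D.ut a r

variable {D}

theorem Stored.of_eq {s t : Memory} (h : D.Stored s) (h1 : t.reg 1 = s.reg 1)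
    (h2 : t.reg 2 = s.reg 2) (h3 : t.reg 3 = s.reg 3) (h0 : t.arr 0 = s.arr 0) : D.Stored t where
  N := h1.trans h.N
  m := h2.trans h.m
  k := h3.trans h.k
  adj := h0 ▸ h.adj
  al := h0 ▸ h.al
  ut := h0 ▸ h.ut

theorem Stored.eval {s : Memory} (h : D.Stored s) (c : Cmd) (h1 : c.ModReg 1 = false)
    (h2 : c.ModReg 2 = false) (h3 : c.ModReg 3 = false) (h0 : c.ModArr 0 = false) :
    D.Stored (c.eval s) :=
  h.of_eq (reg_eval_of_not_modReg c s h1) (reg_eval_of_not_modReg c s h2)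
    (reg_eval_of_not_modReg c s h3) (arr_eval_of_not_modArr c s h0)

theorem Stored.setReg {s : Memory} (h : D.Stored s) {x : ℕ} (hx : 3 < x) (v : ℕ) :
    D.Stored (s.setReg x v) :=
  h.of_eq (by simp; omega) (by simp; omega) (by simp; omega) rfl

end Table

/-- The entry of the adjacency matrix for the agents in registers `x` and `y`. -/
def adjAt (x y : ℕ) : Expr := .get 0 (.add (.num 3) (.add (.mul 1 (.var x)) (.var y)))

/-- The entry of the allocation matrix for the agent in `x` and the resource in `y`. -/
def alAt (x y : ℕ) : Expr :=
  .get 0 (.add (.add (.num 3) (.mul 1 (.var 1))) (.add (.mul 2 (.var x)) (.var y)))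

/-- The entry of the utility matrix for the agent in `x` and the resource in `y`. -/
def utAt (x y : ℕ) : Expr :=
  .get 0 (.add (.add (.add (.num 3) (.mul 1 (.var 1))) (.mul 1 (.var 2)))
    (.add (.mul 2 (.var x)) (.var y)))

/-- Nonzero if and only if the values of `e` and `f` are equal. -/
def eqTest (e f : Expr) : Expr := .sub (.num 1) (.add (.sub e f) (.sub f e))

theorem eval_eqTest {s : Memory} {e f : Expr} :
    (eqTest e f).eval s ≠ 0 ↔ e.eval s = f.eval s := by
  simp only [eqTest, Expr.eval]; omega

namespace Table

variable {D : Table} {s : Memory}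

theorem Stored.adjAt (h : D.Stored s) {x y : ℕ} (hx : s.reg x < D.N) (hy : s.reg y < D.N) :
    (adjAt x y).eval s = D.adj (s.reg x) (s.reg y) := by
  simp [Sharing.adjAt, Expr.eval, h.N, h.adj _ hx _ hy]

theorem Stored.alAt (h : D.Stored s) {x y : ℕ} (hx : s.reg x < D.N) (hy : s.reg y < D.m) :
    (alAt x y).eval s = D.al (s.reg x) (s.reg y) := by
  simp [Sharing.alAt, Expr.eval, h.N, h.m, h.al _ hx _ hy]

theorem Stored.utAt (h : D.Stored s) {x y : ℕ} (hx : s.reg x < D.N) (hy : s.reg y < D.m) :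
    (utAt x y).eval s = D.ut (s.reg x) (s.reg y) := by
  simp [Sharing.utAt, Expr.eval, h.N, h.m, h.ut _ hx _ hy]

end Table

/-- Add the value of the bundle of agent `6` to register `9`. -/
def valueRow : Cmd :=
  .loop 8 2 (.ite (alAt 6 8) (.assign 9 (.add (.var 9) (utAt 6 8))) .skip)

/-- Store the initial values in array `1`. -/
def values : Cmd :=
  .loop 6 1 (.seq (.assign 9 (.num 0)) (.seq valueRow (.store 1 (.var 6) (.var 9))))

/-- Set register `9` to one if some resource of agent `7` is enough for agent `6`. -/
def helpRow : Cmd :=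
  .loop 8 2 (.ite (alAt 7 8)
    -- Comparison by truncated subtraction: `x + 1 - k` is nonzero exactly if `k ≤ x`. Likewise `k -
    -- x` tests `x < k` elsewhere.
    (.ite (.sub (.add (.add (.get 1 (.var 6)) (utAt 6 8)) (.num 1)) (.var 3))
      (.assign 9 (.num 1)) .skip) .skip)

/-- Set register `9` to one if agent `7` can help agent `6`, to zero otherwise. -/
def helpTest : Cmd :=
  .seq (.assign 9 (.num 0)) (.ite (.sub (.var 3) (.get 1 (.var 6)))
    (.ite (.sub (.add (.get 1 (.var 7)) (.num 1)) (.var 3))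
      (.ite (adjAt 7 6) helpRow .skip) .skip) .skip)

/-- Store in array `2` which agent can help which. -/
def helps : Cmd :=
  .loop 6 1 (.loop 7 1 (.seq helpTest
    (.store 2 (.add (.mul 1 (.var 6)) (.var 7)) (.var 9))))

/-- Set register `9` to one if agent `6` owns some object. -/
def ownTest : Cmd :=
  .seq (.assign 9 (.num 0)) (.loop 7 1
    (.ite (eqTest (.get 3 (.var 7)) (.add (.var 6) (.num 1))) (.assign 9 (.num 1)) .skip))

/-- Set register `10` to one more than a bidder without object, or to zero if there is none. -/
def findFree : Cmd :=
  .seq (.assign 10 (.num 0)) (.loop 6 1 (.seq ownTest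
    (.ite (.sub (.var 3) (.get 1 (.var 6)))
      (.ite (.var 9) .skip (.assign 10 (.add (.var 6) (.num 1)))) .skip)))

/-- Set register `11` to one more than a cheapest object for the bidder found by `findFree`, or
to zero if there is none. -/
def findBest : Cmd :=
  .seq (.assign 11 (.num 0)) (.loop 7 1
    (.ite (.get 2 (.add (.mul 1 (.sub (.var 10) (.num 1))) (.var 7)))
      (.ite (.var 11)
        (.ite (.sub (.get 4 (.sub (.var 11) (.num 1))) (.get 4 (.var 7)))
          (.assign 11 (.add (.var 7) (.num 1))) .skip)
        (.assign 11 (.add (.var 7) (.num 1)))) .skip))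

/-- One round of the auction, with owners in array `3` and prices in array `4`. -/
def round : Cmd :=
  .seq findFree (.ite (.var 10) (.seq findBest (.ite (.var 11)
    (.seq (.store 3 (.sub (.var 11) (.num 1)) (.var 10))
      (.store 4 (.sub (.var 11) (.num 1))
        (.add (.get 4 (.sub (.var 11) (.num 1))) (.num 1)))) .skip)) .skip)

/-- The algorithm; register `10` becomes zero if and only if every agent can be helped. -/
def solve : Cmd := .seq values (.seq helps (.seq (.loop 5 0 round) findFree))

/-- Read the numbers of agents and resources and the target. -/
def prepare : Cmd :=
  .seq (.assign 1 (.get 0 (.num 0))) (.seq (.assign 2 (.get 0 (.num 1)))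
    (.assign 3 (.get 0 (.num 2))))

/-- Write the answer. -/
def answer : Cmd := .assign 0 (.sub (.num 1) (.var 10))

/-! ### Correctness of the program -/

namespace Table

variable {D : Table} {s : Memory}

theorem Stored.valueRow (h : D.Stored s) (h6 : s.reg 6 < D.N) (h9 : s.reg 9 = 0) :
    (valueRow.eval s).reg 9 = D.val (s.reg 6) := by
  have := Cmd.eval_loop_induction (x := 8) (y := 2) (s := s)
    (c := .ite (Sharing.alAt 6 8) (.assign 9 (.add (.var 9) (Sharing.utAt 6 8))) .skip)
    (fun i t => D.Stored t ∧ t.reg 6 = s.reg 6 ∧ t.reg 9 = ∑ r ∈ Finset.range i,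
      if D.al (s.reg 6) r ≠ 0 then D.ut (s.reg 6) r else 0) ⟨h, rfl, by simpa using h9⟩ ?_
  · rw [h.m] at this
    exact this.2.2
  · rintro i hi t ⟨ht, ht6, ht9⟩
    rw [h.m] at hi
    have ht' := ht.setReg (x := 8) (by omega) i
    refine ⟨ht'.eval _ rfl rfl rfl rfl, ?_, ?_⟩
    · rw [reg_eval_of_not_modReg _ _ rfl]; simpa using ht6
    · have e1 := ht'.alAt (x := 6) (y := 8) (by simpa [ht6] using h6) (by simpa using hi)
      have e2 := ht'.utAt (x := 6) (y := 8) (by simpa [ht6] using h6) (by simpa using hi)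
      simp [ht6] at e1 e2
      rw [Finset.sum_range_succ, ← ht9]
      by_cases h0 : D.al (s.reg 6) i = 0 <;> simp [Cmd.eval, Expr.eval, e1, e2, h0]

theorem Stored.values (h : D.Stored s) : ∀ b < D.N, (values.eval s).arr 1 b = D.val b := by
  have := Cmd.eval_loop_induction (x := 6) (y := 1) (s := s)
    (c := .seq (.assign 9 (.num 0)) (.seq Sharing.valueRow (.store 1 (.var 6) (.var 9))))
    (fun i t => D.Stored t ∧ ∀ b < i, t.arr 1 b = D.val b) ⟨h, by simp⟩ ?_
  · rw [h.N] at this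
    exact this.2
  · rintro i hi t ⟨ht, hv⟩
    rw [h.N] at hi
    have ht' := (ht.setReg (x := 6) (by omega) i)
    refine ⟨ht'.eval _ rfl rfl rfl rfl, ?_⟩
    have e1 := (ht'.setReg (x := 9) (by omega) 0).valueRow (by simpa using hi) (by simp)
    have e2 := reg_eval_of_not_modReg (z := 6) Sharing.valueRow
      ((t.setReg 6 i).setReg 9 0) rfl
    have e3 := arr_eval_of_not_modArr (a := 1) Sharing.valueRow
      ((t.setReg 6 i).setReg 9 0) rfl
    simp at e1 e2 e3
    intro b hb
    simp [Cmd.eval, Expr.eval, e1, e2, e3, Function.update_apply]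
    split_ifs with hbi
    · rw [hbi]
    · exact hv b (by omega)

theorem Stored.helpRow (h : D.Stored s) (hv : ∀ b < D.N, s.arr 1 b = D.val b)
    (h6 : s.reg 6 < D.N) (h7 : s.reg 7 < D.N) (h9 : s.reg 9 = 0) :
    (helpRow.eval s).reg 9 ≠ 0 ↔
      ∃ r < D.m, D.al (s.reg 7) r ≠ 0 ∧ D.k ≤ D.val (s.reg 6) + D.ut (s.reg 6) r := by
  have := Cmd.eval_loop_induction (x := 8) (y := 2) (s := s)
    (c := .ite (Sharing.alAt 7 8)
      (.ite (.sub (.add (.add (.get 1 (.var 6)) (Sharing.utAt 6 8)) (.num 1)) (.var 3))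
        (.assign 9 (.num 1)) .skip) .skip)
    (fun i t => D.Stored t ∧ t.arr 1 = s.arr 1 ∧ t.reg 6 = s.reg 6 ∧ t.reg 7 = s.reg 7 ∧
      (t.reg 9 ≠ 0 ↔ ∃ r < i, D.al (s.reg 7) r ≠ 0 ∧
        D.k ≤ D.val (s.reg 6) + D.ut (s.reg 6) r)) ⟨h, rfl, rfl, rfl, by simpa using h9⟩ ?_
  · rw [h.m] at this
    exact this.2.2.2.2
  · rintro i hi t ⟨ht, hta, ht6, ht7, ht9⟩
    rw [h.m] at hi
    have ht' := ht.setReg (x := 8) (by omega) i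
    refine ⟨ht'.eval _ rfl rfl rfl rfl, ?_, ?_, ?_, ?_⟩
    · rw [arr_eval_of_not_modArr _ _ rfl]; simpa using hta
    · rw [reg_eval_of_not_modReg _ _ rfl]; simpa using ht6
    · rw [reg_eval_of_not_modReg _ _ rfl]; simpa using ht7
    · have e1 := ht'.alAt (x := 7) (y := 8) (by simpa [ht7] using h7) (by simpa using hi)
      have e2 := ht'.utAt (x := 6) (y := 8) (by simpa [ht6] using h6) (by simpa using hi)
      have e3 := hv _ h6
      simp [ht6, ht7] at e1 e2
      simp only [Nat.lt_succ_iff_lt_or_eq, or_and_right, exists_or, ← ht9, exists_eq_left]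
      have hk := ht.k
      by_cases h0 : D.al (s.reg 7) i = 0
      · simp [Cmd.eval, e1, h0]
      · by_cases h1 : D.k ≤ D.val (s.reg 6) + D.ut (s.reg 6) i
        · simp [Cmd.eval, Expr.eval, e1, e2, hta, ht6, e3, hk, h0, h1,
            show D.val (s.reg 6) + D.ut (s.reg 6) i + 1 - D.k ≠ 0 by omega]
        · simp [Cmd.eval, Expr.eval, e1, e2, hta, ht6, e3, hk, h0, h1,
            show D.val (s.reg 6) + D.ut (s.reg 6) i + 1 - D.k = 0 by omega]

theorem Stored.helpTest (h : D.Stored s) (hv : ∀ b < D.N, s.arr 1 b = D.val b)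
    (h6 : s.reg 6 < D.N) (h7 : s.reg 7 < D.N) :
    (helpTest.eval s).reg 9 ≠ 0 ↔ D.Help (s.reg 6) (s.reg 7) := by
  have h' := h.setReg (x := 9) (by omega) 0
  have e1 := h'.helpRow (by simpa using hv) (by simpa using h6) (by simpa using h7) (by simp)
  have e2 := h'.adjAt (x := 7) (y := 6) (by simpa using h7) (by simpa using h6)
  simp at e1 e2
  have hk := h.k
  have v6 := hv _ h6
  have v7 := hv _ h7
  unfold Help
  by_cases c1 : D.val (s.reg 6) < D.k
  · by_cases c2 : D.k ≤ D.val (s.reg 7)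
    · by_cases c3 : D.adj (s.reg 7) (s.reg 6) = 0
      · simp [Sharing.helpTest, Cmd.eval, Expr.eval, c3, e2]
      · simp [Sharing.helpTest, Cmd.eval, Expr.eval, c1, c2, c3, e1, e2, hk, v6, v7,
          show D.k - D.val (s.reg 6) ≠ 0 by omega, show D.val (s.reg 7) + 1 - D.k ≠ 0 by omega]
    · simp [Sharing.helpTest, Cmd.eval, Expr.eval, c2, hk, v7,
        show D.val (s.reg 7) + 1 - D.k = 0 by omega]
  · simp [Sharing.helpTest, Cmd.eval, Expr.eval, c1, hk, v6,
      show D.k - D.val (s.reg 6) = 0 by omega]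

/-- The tables of initial values and of possible help have been computed. -/
structure Ready (D : Table) (s : Memory) : Prop where
  stored : D.Stored s
  val : ∀ b < D.N, s.arr 1 b = D.val b
  help : ∀ b < D.N, ∀ a < D.N, s.arr 2 (D.N * b + a) ≠ 0 ↔ D.Help b a

/-- Division with remainder; it keeps different entries of the row-major table in array `2` apart.
-/
theorem mul_add_inj {n a b a' b' : ℕ} (hb : b < n) (hb' : b' < n) :
    n * a + b = n * a' + b' ↔ a = a' ∧ b = b' := by
  refine ⟨fun h => ?_, fun h => by rw [h.1, h.2]⟩
  have h1 : (n * a + b) / n = (n * a' + b') / n := by rw [h]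
  rw [Nat.mul_add_div (by omega), Nat.mul_add_div (by omega), Nat.div_eq_of_lt hb,
    Nat.div_eq_of_lt hb'] at h1
  simp only [add_zero] at h1
  subst h1
  exact ⟨rfl, by omega⟩

theorem Stored.helps (h : D.Stored s) (hv : ∀ b < D.N, s.arr 1 b = D.val b) :
    D.Ready (helps.eval s) := by
  -- One pass of the inner loop overwrites exactly the entry of the pair `(b, a)`.
  have key : ∀ b < D.N, ∀ t, D.Stored t → (∀ b < D.N, t.arr 1 b = D.val b) → t.reg 6 = b →
      ∀ a < D.N, t.reg 7 = a → ∀ w, w = (Cmd.seq Sharing.helpTest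
        (.store 2 (.add (.mul 1 (.var 6)) (.var 7)) (.var 9))).eval t → ∀ b' < D.N, ∀ a' < D.N,
        w.arr 2 (D.N * b' + a') ≠ 0 ↔
          if b' = b ∧ a' = a then D.Help b a else t.arr 2 (D.N * b' + a') ≠ 0 := by
    rintro b hb t ht hv h6 a ha h7 w rfl b' hb' a' ha'
    have e1 := ht.helpTest hv (h6 ▸ hb) (h7 ▸ ha)
    have e2 := reg_eval_of_not_modReg (z := 6) Sharing.helpTest t rfl
    have e3 := reg_eval_of_not_modReg (z := 7) Sharing.helpTest t rfl
    have e4 := reg_eval_of_not_modReg (z := 1) Sharing.helpTest t rfl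
    have e5 := arr_eval_of_not_modArr (a := 2) Sharing.helpTest t rfl
    rw [h6, h7] at e1
    simp [Cmd.eval, Expr.eval, e2, e3, e4, e5, h6, h7, ht.N, Function.update_apply,
      mul_add_inj ha' ha, -ne_eq]
    split_ifs with hc
    · exact e1
    · rfl
  have := Cmd.eval_loop_induction (x := 6) (y := 1) (s := s)
    (c := .loop 7 1 (.seq Sharing.helpTest
      (.store 2 (.add (.mul 1 (.var 6)) (.var 7)) (.var 9))))
    (fun i t => D.Stored t ∧ (∀ b < D.N, t.arr 1 b = D.val b) ∧
      ∀ b < i, b < D.N → ∀ a < D.N, t.arr 2 (D.N * b + a) ≠ 0 ↔ D.Help b a)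
    ⟨h, hv, by simp⟩ ?_
  · rw [h.N] at this
    exact ⟨this.1, this.2.1, fun b hb => this.2.2 b hb hb⟩
  rintro i hi t ⟨ht, htv, hth⟩
  rw [h.N] at hi
  have := Cmd.eval_loop_induction (x := 7) (y := 1) (s := t.setReg 6 i)
    (c := .seq Sharing.helpTest (.store 2 (.add (.mul 1 (.var 6)) (.var 7)) (.var 9)))
    (fun j w => D.Stored w ∧ (∀ b < D.N, w.arr 1 b = D.val b) ∧ w.reg 6 = i ∧
      (∀ b < i, b < D.N → ∀ a < D.N, w.arr 2 (D.N * b + a) ≠ 0 ↔ D.Help b a) ∧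
      ∀ a < j, a < D.N → (w.arr 2 (D.N * i + a) ≠ 0 ↔ D.Help i a))
    ⟨ht.setReg (by omega) _, htv, by simp, hth, by simp⟩ ?_
  · have hN : (t.setReg 6 i).reg 1 = D.N := (ht.setReg (by omega) _).N
    rw [hN] at this
    refine ⟨this.1, this.2.1, fun b hb hbN a ha => ?_⟩
    rcases Nat.lt_succ_iff_lt_or_eq.1 hb with hb | rfl
    · exact this.2.2.2.1 b hb hbN a ha
    · exact this.2.2.2.2 a ha ha
  rintro j hj w ⟨hw, hwv, hw6, hwh, hwj⟩
  have hN : (t.setReg 6 i).reg 1 = D.N := (ht.setReg (by omega) _).N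
  rw [hN] at hj
  have hw' := hw.setReg (x := 7) (by omega) j
  have hk := key i hi _ hw' hwv (by simpa using hw6) j hj (by simp) _ rfl
  refine ⟨hw'.eval _ rfl rfl rfl rfl, ?_, ?_, ?_, ?_⟩
  · rw [arr_eval_of_not_modArr _ _ rfl]; exact hwv
  · rw [reg_eval_of_not_modReg _ _ rfl]; simpa using hw6
  · intro b hb hbN a ha
    rw [hk b hbN a ha, if_neg (by omega)]
    exact hwh b hb hbN a ha
  · intro a ha haN
    rw [hk i hi a haN]
    split_ifs with hc
    · rw [hc.2]
    · exact hwj a (by omega) haN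

theorem Ready.of_eq {t : Memory} (h : D.Ready s) (h1 : t.reg 1 = s.reg 1)
    (h2 : t.reg 2 = s.reg 2) (h3 : t.reg 3 = s.reg 3) (h0 : t.arr 0 = s.arr 0)
    (h1' : t.arr 1 = s.arr 1) (h2' : t.arr 2 = s.arr 2) : D.Ready t where
  stored := h.stored.of_eq h1 h2 h3 h0
  val := h1' ▸ h.val
  help := h2' ▸ h.help

theorem Ready.eval (h : D.Ready s) (c : Cmd) (h1 : c.ModReg 1 = false)
    (h2 : c.ModReg 2 = false) (h3 : c.ModReg 3 = false) (h0 : c.ModArr 0 = false)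
    (h1' : c.ModArr 1 = false) (h2' : c.ModArr 2 = false) : D.Ready (c.eval s) :=
  h.of_eq (reg_eval_of_not_modReg c s h1) (reg_eval_of_not_modReg c s h2)
    (reg_eval_of_not_modReg c s h3) (arr_eval_of_not_modArr c s h0)
    (arr_eval_of_not_modArr c s h1') (arr_eval_of_not_modArr c s h2')

theorem Ready.setReg (h : D.Ready s) {x : ℕ} (hx : 3 < x) (v : ℕ) : D.Ready (s.setReg x v) :=
  h.of_eq (by simp; omega) (by simp; omega) (by simp; omega) rfl rfl rfl

theorem ownTest_spec (hN : s.reg 1 = D.N) :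
    (ownTest.eval s).reg 9 ≠ 0 ↔ ∃ a < D.N, s.arr 3 a = s.reg 6 + 1 := by
  have := Cmd.eval_loop_induction (x := 7) (y := 1) (s := s.setReg 9 0)
    (c := .ite (eqTest (.get 3 (.var 7)) (.add (.var 6) (.num 1))) (.assign 9 (.num 1)) .skip)
    (fun i t => t.arr 3 = s.arr 3 ∧ t.reg 6 = s.reg 6 ∧
      (t.reg 9 ≠ 0 ↔ ∃ a < i, s.arr 3 a = s.reg 6 + 1)) ⟨rfl, by simp, by simp⟩ ?_
  · simp only [Memory.reg_setReg, show (1 : ℕ) ≠ 9 by decide, if_false, hN] at this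
    exact this.2.2
  · rintro i - t ⟨ht3, ht6, ht9⟩
    refine ⟨?_, ?_, ?_⟩
    · rw [arr_eval_of_not_modArr _ _ rfl]; simpa using ht3
    · rw [reg_eval_of_not_modReg _ _ rfl]; simpa using ht6
    · simp only [Nat.lt_succ_iff_lt_or_eq, or_and_right, exists_or, ← ht9, exists_eq_left]
      simp only [Cmd.eval, eval_eqTest]
      by_cases hc : s.arr 3 i = s.reg 6 + 1
      · simp [Expr.eval, ht3, ht6, hc]
      · simp [Expr.eval, ht3, ht6, hc]

/-- Later finds overwrite earlier ones; the invariant records only that register `10` points to some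
free bidder, or that none has been met so far. -/
theorem Ready.findFree (h : D.Ready s) :
    ((findFree.eval s).reg 10 = 0 ∧ ∀ b < D.N, D.Low b → ∃ a < D.N, s.arr 3 a = b + 1) ∨
      ∃ b < D.N, (findFree.eval s).reg 10 = b + 1 ∧ D.Low b ∧ ∀ a < D.N, s.arr 3 a ≠ b + 1 := by
  have := Cmd.eval_loop_induction (x := 6) (y := 1) (s := s.setReg 10 0)
    (c := .seq ownTest (.ite (.sub (.var 3) (.get 1 (.var 6)))
      (.ite (.var 9) .skip (.assign 10 (.add (.var 6) (.num 1)))) .skip))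
    (fun i t => D.Ready t ∧ t.arr 3 = s.arr 3 ∧
      ((t.reg 10 = 0 ∧ ∀ b < i, D.Low b → ∃ a < D.N, s.arr 3 a = b + 1) ∨
      ∃ b < D.N, t.reg 10 = b + 1 ∧ D.Low b ∧ ∀ a < D.N, s.arr 3 a ≠ b + 1))
    ⟨h.setReg (by omega) _, rfl, Or.inl ⟨by simp, by simp⟩⟩ ?_
  · simp only [Memory.reg_setReg, show (1 : ℕ) ≠ 10 by decide, if_false, h.stored.N] at this
    exact this.2.2
  rintro i hi t ⟨ht, ht3, ht10⟩
  simp only [Memory.reg_setReg, show (1 : ℕ) ≠ 10 by decide, if_false, h.stored.N] at hi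
  have ht' := ht.setReg (x := 6) (by omega) i
  refine ⟨ht'.eval _ rfl rfl rfl rfl rfl rfl, ?_, ?_⟩
  · rw [arr_eval_of_not_modArr _ _ rfl]; simpa using ht3
  have e1 := ownTest_spec ht'.stored.N
  have e2 := reg_eval_of_not_modReg (z := 6) ownTest (t.setReg 6 i) rfl
  have e3 := reg_eval_of_not_modReg (z := 10) ownTest (t.setReg 6 i) rfl
  have e4 := reg_eval_of_not_modReg (z := 3) ownTest (t.setReg 6 i) rfl
  have e5 := arr_eval_of_not_modArr (a := 1) ownTest (t.setReg 6 i) rfl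
  simp [-ne_eq, ht3] at e1 e2 e3 e4 e5
  have hv := ht.val i hi
  by_cases c1 : D.Low i
  · have c1' : D.k - D.val i ≠ 0 := by unfold Low at c1; omega
    by_cases c2 : ∃ a < D.N, s.arr 3 a = i + 1
    · rw [← e1] at c2
      simp only [Cmd.eval, Expr.eval, e2, e3, e4, e5, hv, ht.stored.k, c1', c2, ne_eq,
        not_false_eq_true, if_true]
      rcases ht10 with ⟨h0, hall⟩ | h1
      · refine Or.inl ⟨h0, fun b hb hl => ?_⟩
        rcases Nat.lt_succ_iff_lt_or_eq.1 hb with hb | rfl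
        · exact hall b hb hl
        · exact e1.1 c2
      · exact Or.inr h1
    · refine Or.inr ⟨i, hi, ?_, c1, fun a ha hc => c2 ⟨a, ha, hc⟩⟩
      rw [← e1, ne_eq, not_not] at c2
      simp [Cmd.eval, Expr.eval, e2, e4, e5, hv, ht.stored.k, c1', c2]
  · have c1' : D.k - D.val i = 0 := by unfold Low at c1; omega
    simp only [Cmd.eval, Expr.eval, e2, e3, e4, e5, hv, ht.stored.k, c1', ne_eq,
      not_true_eq_false, if_false]
    refine ht10.imp (fun h0 => ⟨h0.1, fun b hb hl => ?_⟩) id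
    rcases Nat.lt_succ_iff_lt_or_eq.1 hb with hb | rfl
    · exact h0.2 b hb hl
    · exact absurd hl c1

theorem Ready.findBest (h : D.Ready s) {b : ℕ} (hb : b < D.N) (h10 : s.reg 10 = b + 1) :
    ((findBest.eval s).reg 11 = 0 ∧ ∀ a < D.N, ¬ D.Help b a) ∨
      ∃ a < D.N, (findBest.eval s).reg 11 = a + 1 ∧ D.Help b a ∧
        ∀ a' < D.N, D.Help b a' → s.arr 4 a ≤ s.arr 4 a' := by
  have := Cmd.eval_loop_induction (x := 7) (y := 1) (s := s.setReg 11 0)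
    (c := .ite (.get 2 (.add (.mul 1 (.sub (.var 10) (.num 1))) (.var 7)))
      (.ite (.var 11)
        (.ite (.sub (.get 4 (.sub (.var 11) (.num 1))) (.get 4 (.var 7)))
          (.assign 11 (.add (.var 7) (.num 1))) .skip)
        (.assign 11 (.add (.var 7) (.num 1)))) .skip)
    (fun i t => D.Ready t ∧ t.arr 4 = s.arr 4 ∧ t.reg 10 = b + 1 ∧
      ((t.reg 11 = 0 ∧ ∀ a < i, ¬ D.Help b a) ∨
      ∃ a < D.N, t.reg 11 = a + 1 ∧ D.Help b a ∧
        ∀ a' < i, D.Help b a' → s.arr 4 a ≤ s.arr 4 a'))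
    ⟨h.setReg (by omega) _, rfl, by simpa using h10, Or.inl ⟨by simp, by simp⟩⟩ ?_
  · simp only [Memory.reg_setReg, show (1 : ℕ) ≠ 11 by decide, if_false, h.stored.N] at this
    exact this.2.2.2
  rintro i hi t ⟨ht, ht4, ht10, ht11⟩
  simp only [Memory.reg_setReg, show (1 : ℕ) ≠ 11 by decide, if_false, h.stored.N] at hi
  have ht' := ht.setReg (x := 7) (by omega) i
  refine ⟨ht'.eval _ rfl rfl rfl rfl rfl rfl, ?_, ?_, ?_⟩
  · rw [arr_eval_of_not_modArr _ _ rfl]; simpa using ht4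
  · rw [reg_eval_of_not_modReg _ _ rfl]; simpa using ht10
  have hh := ht.help b hb i hi
  have hN := ht.stored.N
  by_cases c1 : D.Help b i
  · have c1' := hh.2 c1
    rcases ht11 with ⟨h0, hall⟩ | ⟨a, ha, h1, h2, h3⟩
    · refine Or.inr ⟨i, hi, ?_, c1, fun a' ha' hb' => ?_⟩
      · simp [Cmd.eval, Expr.eval, ht10, hN, c1', h0]
      · rcases Nat.lt_succ_iff_lt_or_eq.1 ha' with ha' | rfl
        · exact absurd hb' (hall a' ha')
        · exact le_rfl
    · by_cases c2 : s.arr 4 a - s.arr 4 i = 0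
      · refine Or.inr ⟨a, ha, ?_, h2, fun a' ha' hb' => ?_⟩
        · simp [Cmd.eval, Expr.eval, ht10, hN, c1', h1, ht4, c2]
        · rcases Nat.lt_succ_iff_lt_or_eq.1 ha' with ha' | rfl
          · exact h3 a' ha' hb'
          · omega
      · refine Or.inr ⟨i, hi, ?_, c1, fun a' ha' hb' => ?_⟩
        · simp [Cmd.eval, Expr.eval, ht10, hN, c1', h1, ht4, c2]
        · rcases Nat.lt_succ_iff_lt_or_eq.1 ha' with ha' | rfl
          · have := h3 a' ha' hb'
            omega
          · exact le_rfl
  · have c1' : t.arr 2 (D.N * b + i) = 0 := by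
      by_contra hc; exact c1 (hh.1 hc)
    simp only [Cmd.eval, Expr.eval, Memory.reg_setReg, Memory.arr_setReg, ht10, hN,
      Nat.add_sub_cancel, c1', show (10 : ℕ) ≠ 7 by decide, show (1 : ℕ) ≠ 7 by decide,
      show (11 : ℕ) ≠ 7 by decide, if_false, if_true, ne_eq, not_true_eq_false]
    refine ht11.imp (fun h0 => ⟨h0.1, fun a' ha' hb' => ?_⟩)
      fun ⟨a, ha, h1, h2, h3⟩ => ⟨a, ha, h1, h2, fun a' ha' hb' => ?_⟩
    · rcases Nat.lt_succ_iff_lt_or_eq.1 ha' with ha' | rfl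
      · exact h0.2 a' ha' hb'
      · exact c1 hb'
    · rcases Nat.lt_succ_iff_lt_or_eq.1 ha' with ha' | rfl
      · exact h3 a' ha' hb'
      · exact absurd hb' c1

/-- The state of the auction after `i` rounds. -/
structure Progress (D : Table) (i : ℕ) (s : Memory) : Prop where
  ready : D.Ready s
  inv : Auction.Inv D.N D.Low D.Help (s.arr 3) (s.arr 4)
  done : ¬ Auction.Perfect D.N D.Low D.Help ∨
    (∀ b < D.N, D.Low b → ∃ a < D.N, s.arr 3 a = b + 1) ∨
    i ≤ ∑ a ∈ Finset.range D.N, s.arr 4 a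

/-- Either nobody is left to bid and owners and prices stay as they are, or a bidder without any
possible helper excludes a perfect assignment, or a bid raises the sum of prices by one. -/
theorem Progress.round {i : ℕ} (h : D.Progress i s) : D.Progress (i + 1) (round.eval s) := by
  have hr := h.ready.eval Sharing.round rfl rfl rfl rfl rfl rfl
  have f3 := arr_eval_of_not_modArr (a := 3) Sharing.findFree s rfl
  have f4 := arr_eval_of_not_modArr (a := 4) Sharing.findFree s rfl
  rcases h.ready.findFree with ⟨h10, hall⟩ | ⟨b, hb, h10, hlow, hun⟩
  · have e : Sharing.round.eval s = Sharing.findFree.eval s := by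
      simp [Sharing.round, Cmd.eval, Expr.eval, h10]
    refine ⟨hr, ?_, Or.inr (Or.inl ?_)⟩
    · rw [e, f3, f4]; exact h.inv
    · rw [e, f3]; exact hall
  have hready := h.ready.eval Sharing.findFree rfl rfl rfl rfl rfl rfl
  set t := Sharing.findFree.eval s with ht
  have g3 := arr_eval_of_not_modArr (a := 3) Sharing.findBest t rfl
  have g4 := arr_eval_of_not_modArr (a := 4) Sharing.findBest t rfl
  have g10 := reg_eval_of_not_modReg (z := 10) Sharing.findBest t rfl
  rcases hready.findBest hb h10 with ⟨h11, hnone⟩ | ⟨a, ha, h11, hba, hmin⟩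
  · have e : Sharing.round.eval s = Sharing.findBest.eval t := by
      simp [Sharing.round, Cmd.eval, Expr.eval, h10, ← ht, h11]
    refine ⟨hr, ?_, Or.inl ?_⟩
    · rw [e, g3, f3, g4, f4]; exact h.inv
    · rintro ⟨f, hf, -⟩
      exact hnone _ (hf b hb hlow).1 (hf b hb hlow).2
  · rw [f4] at hmin
    have e3 : (Sharing.round.eval s).arr 3 = Function.update (s.arr 3) a (b + 1) := by
      simp [Sharing.round, Cmd.eval, Expr.eval, h10, ← ht, h11, g3, f3, g10]
    have e4 : (Sharing.round.eval s).arr 4 = Function.update (s.arr 4) a (s.arr 4 a + 1) := by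
      simp [Sharing.round, Cmd.eval, Expr.eval, h10, ← ht, h11, g4, f4]
    refine ⟨hr, ?_, h.done.imp id fun hd => Or.inr ?_⟩
    · rw [e3, e4]
      exact h.inv.bid ha hb hlow hun hba hmin
    · rw [e4, Auction.sum_update_price ha]
      rcases hd with hd | hd
      · obtain ⟨a', ha', hc⟩ := hd b hb hlow
        exact absurd hc (hun a' ha')
      · omega

/-- Register `0` is the number of rounds. A bidder still free at the end leaves two cases of
`Progress.done`: a perfect assignment is already excluded, or the sum of prices has reached the
number of rounds and so exceeds `N * N`. -/
theorem Stored.solve (h : D.Stored s) (h3 : s.arr 3 = fun _ => 0) (h4 : s.arr 4 = fun _ => 0)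
    (hT : D.N * D.N < s.reg 0) :
    (solve.eval s).reg 10 = 0 ↔ Auction.Perfect D.N D.Low D.Help := by
  have h1 := h.eval Sharing.values rfl rfl rfl rfl
  have h2 := h1.helps h.values
  have f3 := arr_eval_of_not_modArr (a := 3) (.seq Sharing.values Sharing.helps) s rfl
  have f4 := arr_eval_of_not_modArr (a := 4) (.seq Sharing.values Sharing.helps) s rfl
  have f0 := reg_eval_of_not_modReg (z := 0) (.seq Sharing.values Sharing.helps) s rfl
  simp only [Cmd.eval] at f3 f4 f0
  have h5 := Cmd.eval_loop_induction (x := 5) (y := 0) (c := Sharing.round)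
    (fun i t => D.Progress i t)
    ⟨h2, by rw [f3, f4, h3, h4]; exact Auction.inv_zero, Or.inr (Or.inr (Nat.zero_le _))⟩
    fun i _ t ht => Progress.round
      ⟨ht.ready.setReg (x := 5) (by omega) i, ht.inv, ht.done⟩
  rw [f0] at h5
  set w := (Cmd.loop 5 0 Sharing.round).eval (Sharing.helps.eval (Sharing.values.eval s)) with hw
  have e : Sharing.solve.eval s = Sharing.findFree.eval w := by
    simp only [Sharing.solve, Cmd.eval, hw]
  rw [e]
  rcases h5.ready.findFree with ⟨h10, hall⟩ | ⟨b, hb, h10, hlow, hun⟩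
  · exact ⟨fun _ => h5.inv.perfect hall, fun _ => h10⟩
  · refine ⟨fun hc => by omega, fun hp => ?_⟩
    rcases h5.done with hd | hd | hd
    · exact absurd hp hd
    · obtain ⟨a, ha, hc⟩ := hd b hb hlow
      exact absurd hc (hun a ha)
    · exact absurd hp (h5.inv.not_perfect_of_sum (by omega))

end Table

end Sharing

/-! ## Simple sharings and matchings -/

namespace Sharing

namespace Instance

set_option linter.unusedSectionVars false

variable {A R : Type*} [Fintype A] [Fintype R] (I : Instance A R)

theorem mem_upper {a : A} : a ∈ I.upper ↔ I.target ≤ I.value a (I.alloc a) := by simp [upper]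

theorem mem_lower {a : A} : a ∈ I.lower ↔ I.value a (I.alloc a) < I.target := by simp [lower]

theorem notMem_lower_of_mem_upper {a : A} (h : a ∈ I.upper) : a ∉ I.lower := by
  rw [mem_upper] at h; rw [mem_lower]; omega

theorem mem_exchanged {δ : I.graph.edgeSet → Finset R} {a : A} {r : R} :
    r ∈ I.exchanged δ a ↔ ∃ e : I.graph.edgeSet, a ∈ e.1 ∧ r ∈ δ e := by
  simp [exchanged]

theorem mem_bundle {δ : I.graph.edgeSet → Finset R} {a : A} {r : R} :
    r ∈ I.bundle δ a ↔ r ∈ I.alloc a ∨ r ∈ I.exchanged δ a := by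
  simp [bundle]

theorem eq_of_mem_alloc {a b : A} {r : R} (ha : r ∈ I.alloc a) (hb : r ∈ I.alloc b) : a = b := by
  by_contra h
  exact Finset.disjoint_left.1 (I.alloc_disjoint a b h) ha hb

theorem value_mono (a : A) {S T : Finset R} (h : S ⊆ T) : I.value a S ≤ I.value a T :=
  Finset.sum_le_sum_of_subset h

theorem helpGraph_isBipartiteWith :
    I.helpGraph.IsBipartiteWith (I.upper : Set A) (I.lower : Set A) where
  disjoint := Set.disjoint_left.2 fun _ h => I.notMem_lower_of_mem_upper h
  mem_of_adj := fun _ _ h => h.imp (fun h => ⟨h.1, h.2.1⟩) fun h => ⟨h.2.1, h.1⟩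

/-- The lower agents can be helped by different agents. -/
def Helpable : Prop :=
  ∃ f : A → A, (∀ b ∈ I.lower, I.CanHelp (f b) b) ∧ Set.InjOn f I.lower

theorem le_egalitarianWelfare [Nonempty A] {B : A → Finset R} :
    I.target ≤ I.egalitarianWelfare B ↔ ∀ a, I.target ≤ I.value a (B a) := by
  simp [egalitarianWelfare]

variable {I}

theorem helpable_of_ewsa [Nonempty A] (h : I.EWSA 1) : I.Helpable := by
  classical
  obtain ⟨δ, ⟨⟨hδ, h2⟩, h1⟩, hw⟩ := h
  rw [le_egalitarianWelfare] at hw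
  have key : ∀ b ∈ I.lower, ∃ a, I.CanHelp a b ∧
      ∃ r ∈ I.alloc a, r ∈ I.exchanged δ a ∧ r ∈ I.exchanged δ b := by
    intro b hb
    -- Otherwise the bundle of `b` would not grow and would stay below the target.
    have hval : ∃ r ∈ I.exchanged δ b, r ∉ I.alloc b := by
      by_contra! hcon
      have hsub : I.bundle δ b ⊆ I.alloc b := fun r hr =>
        ((I.mem_bundle).1 hr).elim id (hcon r)
      have := I.value_mono b hsub
      have := hw b
      rw [mem_lower] at hb
      omega
    obtain ⟨r, hr, hrb⟩ := hval
    obtain ⟨e, hbe, hre⟩ := (I.mem_exchanged).1 hr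
    obtain ⟨a, hae, hra⟩ := hδ e r hre
    have hab : a ≠ b := fun h => hrb (h ▸ hra)
    have hradj : I.graph.Adj a b := by
      have := (Sym2.mem_and_mem_iff hab).1 ⟨hae, hbe⟩
      rw [← SimpleGraph.mem_edgeSet, ← this]
      exact e.2
    have hrexa : r ∈ I.exchanged δ a := (I.mem_exchanged).2 ⟨e, hae, hre⟩
    refine ⟨a, ⟨?_, hb, hradj, r, hra, ?_⟩, r, hra, hrexa, hr⟩
    -- The only resource that `a` exchanges is `r`, which it holds anyway, so its initial bundle
    -- already has the final value.
    · rw [mem_upper]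
      refine (hw a).trans (I.value_mono a fun r' hr' => ?_)
      rcases (I.mem_bundle).1 hr' with h | h
      · exact h
      · rwa [Finset.card_le_one.1 (h1 a) r' h r hrexa]
    · have hsub : I.bundle δ b ⊆ insert r (I.alloc b) := fun r' hr' => by
        rcases (I.mem_bundle).1 hr' with h | h
        · exact Finset.mem_insert_of_mem h
        · rw [Finset.card_le_one.1 (h1 b) r' h r hr]
          exact Finset.mem_insert_self _ _
      have h3 := (hw b).trans (I.value_mono b hsub)
      rw [value, Finset.sum_insert hrb, add_comm] at h3
      exact h3
  choose! f hf hg using key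
  refine ⟨f, hf, fun b hb b' hb' hbb' => ?_⟩
  by_contra hne
  have hlow : ∀ c ∈ I.lower, f c ≠ c := fun c hc h => by
    have := (hf c hc).2.2.1
    rw [h] at this
    exact I.graph.irrefl this
  have hb₀ : b ∈ I.lower := hb
  have hb₁ : b' ∈ I.lower := hb'
  obtain ⟨r, g1, g2, g3⟩ := hg b hb₀
  obtain ⟨r', g1', g2', g3'⟩ := hg b' hb₁
  rw [← hbb'] at g2'
  -- The common helper exchanges one resource only, so `r' = r`, and `r` is in the bundles of the
  -- helper, `b` and `b'`.
  rw [Finset.card_le_one.1 (h1 (f b)) _ g2' _ g2] at g3'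
  exact h2 (f b) b b' (hlow b hb₀) (hbb' ▸ hlow b' hb₁) hne r
    ⟨(I.mem_bundle).2 (Or.inl g1), (I.mem_bundle).2 (Or.inr g3), (I.mem_bundle).2 (Or.inr g3')⟩

theorem ewsa_of_helpable [Nonempty A] (h : I.Helpable) : I.EWSA 1 := by
  classical
  obtain ⟨f, hf, hinj⟩ := h
  choose hup hlow hadj g hg hgt using hf
  -- The edge from `f b` to `b` carries the helping resource `g b`; all other edges carry nothing.
  set δ : I.graph.edgeSet → Finset R := fun e =>
    Finset.univ.filter fun r => ∃ (b : A) (hb : b ∈ I.lower), e.1 = s(f b, b) ∧ r = g b hb with hδ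
  have hex : ∀ a r, r ∈ I.exchanged δ a ↔ ∃ (b : A) (hb : b ∈ I.lower),
      (a = f b ∨ a = b) ∧ r = g b hb := by
    intro a r
    rw [mem_exchanged]
    constructor
    · rintro ⟨e, hae, hr⟩
      simp only [hδ, Finset.mem_filter, Finset.mem_univ, true_and] at hr
      obtain ⟨b, hb, he, rfl⟩ := hr
      rw [he, Sym2.mem_iff] at hae
      exact ⟨b, hb, hae, rfl⟩
    · rintro ⟨b, hb, hab, rfl⟩
      refine ⟨⟨s(f b, b), hadj b hb⟩, Sym2.mem_iff.2 hab, ?_⟩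
      simp only [hδ, Finset.mem_filter, Finset.mem_univ, true_and]
      exact ⟨b, hb, rfl, rfl⟩
  -- Helpers are upper agents and the helped are lower ones, so with injectivity no agent occurs in
  -- two helping pairs.
  have hcase : ∀ b ∈ I.lower, ∀ b' ∈ I.lower, ∀ a, (a = f b ∨ a = b) → (a = f b' ∨ a = b') →
      b = b' := by
    rintro b hb b' hb' a (rfl | rfl) (h | h)
    · exact hinj hb hb' h
    · exact absurd (h ▸ hb') (I.notMem_lower_of_mem_upper (hup b hb))
    · exact absurd (h ▸ hb) (I.notMem_lower_of_mem_upper (hup b' hb'))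
    · exact h
  refine ⟨δ, ⟨⟨?_, ?_⟩, ?_⟩, ?_⟩
  · intro e r hr
    simp only [hδ, Finset.mem_filter, Finset.mem_univ, true_and] at hr
    obtain ⟨b, hb, he, rfl⟩ := hr
    exact ⟨f b, he ▸ Sym2.mem_mk_left _ _, hg b hb⟩
  · rintro a b c hab hac hbc r ⟨ha, hb, hc⟩
    obtain ⟨o, ho⟩ := I.alloc_complete r
    -- Besides its holder `o`, only a lower agent helped by `o` can have `r`, and by injectivity
    -- there is at most one such agent.
    have hmem : ∀ x, r ∈ I.bundle δ x → x = o ∨ x ∈ I.lower ∧ f x = o := by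
      intro x hx
      rw [mem_bundle, hex] at hx
      rcases hx with hx | ⟨b', hb', rfl | rfl, rfl⟩
      · exact Or.inl (I.eq_of_mem_alloc hx ho)
      · exact Or.inl (I.eq_of_mem_alloc (hg b' hb') ho)
      · exact Or.inr ⟨hb', I.eq_of_mem_alloc (hg _ hb') ho⟩
    rcases hmem a ha with rfl | ⟨ha, ha'⟩ <;> rcases hmem b hb with rfl | ⟨hb, hb'⟩ <;>
      rcases hmem c hc with rfl | ⟨hc, hc'⟩
    · exact hab rfl
    · exact hab rfl
    · exact hac rfl
    · exact hbc (hinj hb hc (hb'.trans hc'.symm))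
    · exact hbc rfl
    · exact hac (hinj ha hc (ha'.trans hc'.symm))
    · exact hab (hinj ha hb (ha'.trans hb'.symm))
    · exact hab (hinj ha hb (ha'.trans hb'.symm))
  · intro a
    refine Finset.card_le_one.2 fun r hr r' hr' => ?_
    rw [hex] at hr hr'
    obtain ⟨b, hb, hab, rfl⟩ := hr
    obtain ⟨b', hb', hab', rfl⟩ := hr'
    obtain rfl := hcase b hb b' hb' a hab hab'
    rfl
  · rw [le_egalitarianWelfare]
    intro a
    by_cases ha : a ∈ I.lower
    · have hga : g a ha ∉ I.alloc a := fun h => by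
        have h1 := I.eq_of_mem_alloc h (hg a ha)
        exact (hadj a ha).ne h1.symm
      have h1 : I.value a (insert (g a ha) (I.alloc a)) ≤ I.value a (I.bundle δ a) := by
        refine I.value_mono a fun r hr => ?_
        rw [mem_bundle, hex]
        rcases Finset.mem_insert.1 hr with rfl | hr
        · exact Or.inr ⟨a, ha, Or.inr rfl, rfl⟩
        · exact Or.inl hr
      rw [value, Finset.sum_insert hga, add_comm] at h1
      exact (hgt a ha).trans h1
    · rw [mem_lower, not_lt] at ha
      exact ha.trans (I.value_mono a fun r hr => (I.mem_bundle).2 (Or.inl hr))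

theorem ewsa_one_iff_helpable [Nonempty A] : I.EWSA 1 ↔ I.Helpable :=
  ⟨helpable_of_ewsa, ewsa_of_helpable⟩

/-! ### Matchings of the help graph -/

theorem CanHelp.adj {a b : A} (h : I.CanHelp a b) : I.helpGraph.Adj a b := Or.inl h

theorem canHelp_of_adj {a b : A} (h : I.helpGraph.Adj a b) (hb : b ∈ I.lower) : I.CanHelp a b :=
  h.elim id fun h' => absurd hb (I.notMem_lower_of_mem_upper h'.1)

/-- The edges are the pairs `s(f b, b)`. As helpers are never lower agents, each vertex has one
partner and each edge determines its `b`. -/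
theorem exists_matching_of_helpable (h : I.Helpable) :
    ∃ M : I.helpGraph.Subgraph, M.IsMatching ∧ M.edgeSet.ncard = I.lower.card := by
  classical
  obtain ⟨f, hf, hinj⟩ := h
  have hup : ∀ b ∈ I.lower, f b ∉ I.lower := fun b hb =>
    I.notMem_lower_of_mem_upper (hf b hb).1
  let M : I.helpGraph.Subgraph :=
    { verts := {a | ∃ b ∈ I.lower, a = f b ∨ a = b}
      Adj := fun a c => (c ∈ I.lower ∧ a = f c) ∨ (a ∈ I.lower ∧ c = f a)
      adj_sub := by
        rintro a c (⟨h, rfl⟩ | ⟨h, rfl⟩)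
        · exact (hf c h).adj
        · exact (hf a h).adj.symm
      edge_vert := by
        rintro a c (⟨h, rfl⟩ | ⟨h, rfl⟩)
        · exact ⟨c, h, Or.inl rfl⟩
        · exact ⟨a, h, Or.inr rfl⟩
      symm := ⟨fun _ _ h => h.symm⟩ }
  refine ⟨M, ?_, ?_⟩
  · rintro a ⟨b, hb, rfl | rfl⟩
    · refine ⟨b, Or.inl ⟨hb, rfl⟩, ?_⟩
      rintro c (⟨hc, h⟩ | ⟨hc, -⟩)
      · exact (hinj hb hc h).symm
      · exact absurd hc (hup b hb)
    · refine ⟨f a, Or.inr ⟨hb, rfl⟩, ?_⟩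
      rintro c (⟨hc, h⟩ | ⟨-, h⟩)
      · exact absurd (h ▸ hb) (hup c hc)
      · exact h
  · have : M.edgeSet = (fun b => s(f b, b)) '' (I.lower : Set A) := by
      ext e
      induction e using Sym2.ind with
      | _ a c =>
        rw [SimpleGraph.Subgraph.mem_edgeSet, Set.mem_image]
        constructor
        · rintro (⟨h, rfl⟩ | ⟨h, rfl⟩)
          · exact ⟨c, h, rfl⟩
          · exact ⟨a, h, Sym2.eq_swap⟩
        · rintro ⟨b, hb, h⟩
          rcases Sym2.eq_iff.1 h with ⟨rfl, rfl⟩ | ⟨rfl, rfl⟩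
          · exact Or.inl ⟨hb, rfl⟩
          · exact Or.inr ⟨hb, rfl⟩
    have hinj' : Set.InjOn (fun b => s(f b, b)) (I.lower : Set A) := by
      intro b hb b' hb' h
      rcases Sym2.eq_iff.1 h with ⟨-, h⟩ | ⟨h, -⟩
      · exact h
      · exact absurd (h ▸ hb') (hup b hb)
    rw [this, hinj'.ncard_image, Set.ncard_coe_finset]

/-- Each edge has a lower end, and different edges of a matching have different ones. With as many
edges as lower agents, every lower agent is matched. -/
theorem helpable_of_matching [Nonempty A] {M : I.helpGraph.Subgraph} (hM : M.IsMatching)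
    (hcard : M.edgeSet.ncard = I.lower.card) : I.Helpable := by
  classical
  have hlow : ∀ e ∈ M.edgeSet, ∃ b ∈ I.lower, ∃ a, e = s(a, b) ∧ M.Adj a b := by
    intro e he
    induction e using Sym2.ind with
    | _ a c =>
      rw [SimpleGraph.Subgraph.mem_edgeSet] at he
      rcases M.adj_sub he with h | h
      · exact ⟨c, h.2.1, a, rfl, he⟩
      · exact ⟨a, h.2.1, c, Sym2.eq_swap, he.symm⟩
  choose! β hβ α hα hadj using hlow
  have hinj : Set.InjOn β M.edgeSet := by
    intro e he e' he' h
    rw [hα e he, hα e' he', ← h]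
    have h1 := hadj e he
    have h2 := hadj e' he'
    rw [← h] at h2
    rw [hM.eq_of_adj_right h1 h2]
  have himg : β '' M.edgeSet = (I.lower : Set A) := by
    refine Set.eq_of_subset_of_ncard_le (fun b ⟨e, he, hb⟩ => hb ▸ hβ e he) ?_
    rw [hinj.ncard_image, hcard, Set.ncard_coe_finset]
  have hpartner : ∀ b ∈ I.lower, ∃ a, M.Adj a b := by
    intro b hb
    obtain ⟨e, he, rfl⟩ : b ∈ β '' M.edgeSet := himg ▸ hb
    exact ⟨α e, hadj e he⟩
  choose! f hf using hpartner
  refine ⟨f, fun b hb => canHelp_of_adj (M.adj_sub (hf b hb)) hb, fun b hb b' hb' h => ?_⟩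
  have h2 := hf b' hb'
  rw [← h] at h2
  exact hM.eq_of_adj_left (hf b hb) h2

end Instance

end Sharing

/-! ## Instances as words -/

namespace Sharing

open RAM

theorem length_flatMap_finRange {n m : ℕ} (f : Fin n → Fin m → ℕ) :
    ((List.finRange n).flatMap fun a => (List.finRange m).map (f a)).length = n * m := by
  simp [List.length_flatMap]

theorem getD_flatMap_map {α β : Type*} (l : List α) (l' : List β) (f : α → β → ℕ) {i j : ℕ}
    (hi : i < l.length) (hj : j < l'.length) :
    (l.flatMap fun a => l'.map (f a)).getD (l'.length * i + j) 0 = f l[i] l'[j] := by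
  induction l generalizing i with
  | nil => simp at hi
  | cons a l ih =>
    rw [List.flatMap_cons]
    cases i with
    | zero =>
      rw [List.getD_append _ _ _ _ (by simpa using hj)]
      simp [hj]
    | succ i =>
      rw [List.getD_append_right _ _ _ _ (by rw [List.length_map, mul_add_one]; omega)]
      have := ih (by simpa using hi)
      rw [List.length_map, show l'.length * (i + 1) + j - l'.length = l'.length * i + j by
        rw [mul_add_one]; omega, this]
      simp

theorem getD_flatMap_finRange {n m : ℕ} (f : Fin n → Fin m → ℕ) (a : Fin n) (b : Fin m) :
    ((List.finRange n).flatMap fun a => (List.finRange m).map (f a)).getD (m * a + b) 0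
      = f a b := by
  have := getD_flatMap_map (List.finRange n) (List.finRange m) f (i := a) (j := b)
    (by simp) (by simp)
  simpa using this

namespace NumberedInstance

variable (x : NumberedInstance)

open Classical in
/-- The tables of a numbered instance, extended by zero. -/
noncomputable def table : Table where
  N := x.n + 1
  m := x.m
  k := x.inst.target
  adj a b := if h : a < x.n + 1 ∧ b < x.n + 1 then
    if x.inst.graph.Adj ⟨a, h.1⟩ ⟨b, h.2⟩ then 1 else 0 else 0
  al a r := if h : a < x.n + 1 ∧ r < x.m then
    if (⟨r, h.2⟩ : Fin x.m) ∈ x.inst.alloc ⟨a, h.1⟩ then 1 else 0 else 0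
  ut a r := if h : a < x.n + 1 ∧ r < x.m then x.inst.utility ⟨a, h.1⟩ ⟨r, h.2⟩ else 0

theorem length_encode : x.encode.length = 3 + (x.n + 1) * (x.n + 1) + (x.n + 1) * x.m
    + (x.n + 1) * x.m := by
  simp only [encode, List.length_append, length_flatMap_finRange]
  rfl

theorem stored_prepare : x.table.Stored (prepare.eval (init x.encode)) := by
  classical
  have h0 : (prepare.eval (init x.encode)).arr 0 = fun i => x.encode.getD i 0 := rfl
  have e3 : ([x.n + 1, x.m, x.inst.target] : List ℕ).length = 3 := rfl
  refine ⟨rfl, rfl, rfl, ?_, ?_, ?_⟩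
  · intro a ha b hb
    simp only [table] at ha hb ⊢
    rw [h0, dif_pos ⟨ha, hb⟩]
    simp only [encode]
    -- The position stays inside the block of the adjacency matrix, so the two later blocks can be
    -- dropped.
    have hlt : (x.n + 1) * a + b < (x.n + 1) * (x.n + 1) := by nlinarith
    rw [List.getD_append _ _ _ _ (by
        simp only [List.length_append, length_flatMap_finRange, e3]; omega),
      List.getD_append _ _ _ _ (by
        simp only [List.length_append, length_flatMap_finRange, e3]; omega),
      List.getD_append_right _ _ _ _ (by rw [e3]; omega), e3, Nat.add_sub_cancel_left]
    exact getD_flatMap_finRange _ (⟨a, ha⟩ : Fin (x.n + 1)) (⟨b, hb⟩ : Fin (x.n + 1))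
  · intro a ha b hb
    simp only [table] at ha hb ⊢
    rw [h0, dif_pos ⟨ha, hb⟩]
    simp only [encode]
    have hlt : x.m * a + b < (x.n + 1) * x.m := by nlinarith
    rw [List.getD_append _ _ _ _ (by
        simp only [List.length_append, length_flatMap_finRange, e3]; omega),
      List.getD_append_right _ _ _ _ (by
        simp only [List.length_append, length_flatMap_finRange, e3]; omega)]
    simp only [List.length_append, length_flatMap_finRange, e3, Nat.add_sub_cancel_left]
    exact getD_flatMap_finRange _ (⟨a, ha⟩ : Fin (x.n + 1)) (⟨b, hb⟩ : Fin x.m)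
  · intro a ha b hb
    simp only [table] at ha hb ⊢
    rw [h0, dif_pos ⟨ha, hb⟩]
    simp only [encode]
    rw [List.getD_append_right _ _ _ _ (by
        simp only [List.length_append, length_flatMap_finRange, e3]; omega)]
    simp only [List.length_append, length_flatMap_finRange, e3, Nat.add_sub_cancel_left]
    exact getD_flatMap_finRange _ (⟨a, ha⟩ : Fin (x.n + 1)) (⟨b, hb⟩ : Fin x.m)

theorem val_table (a : Fin (x.n + 1)) : x.table.val a = x.inst.value a (x.inst.alloc a) := by
  classical
  have : x.inst.alloc a = Finset.univ.filter (· ∈ x.inst.alloc a) := by ext; simp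
  rw [Table.val, Instance.value, this, Finset.sum_filter]
  change ∑ r ∈ Finset.range x.m, _ = _
  rw [Finset.sum_range]
  refine Finset.sum_congr rfl fun r _ => ?_
  simp [table, Fin.is_le a]

/-- Only agents below `N` matter on the side of natural numbers, so reduction by `Fin.ofNat` loses
nothing. Note the order of arguments: `Help` takes the bidder first, `CanHelp` the helper. -/
theorem perfect_iff_helpable :
    Auction.Perfect x.table.N x.table.Low x.table.Help ↔ x.inst.Helpable := by
  classical
  have hlow : ∀ b : Fin (x.n + 1), x.table.Low b ↔ b ∈ x.inst.lower := fun b => by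
    rw [Table.Low, val_table, Instance.mem_lower]
    rfl
  have hhelp : ∀ a b : Fin (x.n + 1), x.table.Help b a ↔ x.inst.CanHelp a b := fun a b => by
    rw [Table.Help, Instance.CanHelp, Instance.mem_lower, Instance.mem_upper, val_table,
      val_table]
    have hadj : x.table.adj a b ≠ 0 ↔ x.inst.graph.Adj a b := by
      simp [table, Fin.is_le a, Fin.is_le b]
    have hres : (∃ r < x.table.m, x.table.al a r ≠ 0 ∧
        x.table.k ≤ x.inst.value b (x.inst.alloc b) + x.table.ut b r) ↔
        ∃ r ∈ x.inst.alloc a, x.inst.target ≤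
          x.inst.value b (x.inst.alloc b) + x.inst.utility b r := by
      constructor
      · rintro ⟨r, hr, h1, h2⟩
        have hr' : r < x.m := hr
        refine ⟨⟨r, hr'⟩, by simpa [table, hr', Fin.is_le a] using h1,
          by simpa [table, hr', Fin.is_le b] using h2⟩
      · rintro ⟨r, h1, h2⟩
        exact ⟨r, r.2, by simpa [table, Fin.is_le a] using h1,
          by simpa [table, Fin.is_le b] using h2⟩
    rw [hadj, hres]
    exact ⟨fun ⟨h1, h2, h3⟩ => ⟨h2, h1, h3⟩, fun ⟨h1, h2, h3⟩ => ⟨h2, h1, h3⟩⟩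
  constructor
  · rintro ⟨f, hf, hinj⟩
    refine ⟨fun b => Fin.ofNat (x.n + 1) (f b), fun b hb => ?_, fun b hb b' hb' h => ?_⟩
    · have h1 := hf b b.2 ((hlow b).2 hb)
      have hlt : f b < x.n + 1 := h1.1
      rw [← hhelp, Fin.val_ofNat, Nat.mod_eq_of_lt hlt]
      exact h1.2
    · have h1 : f b < x.n + 1 := (hf b b.2 ((hlow b).2 hb)).1
      have h1' : f b' < x.n + 1 := (hf b' b'.2 ((hlow b').2 hb')).1
      have h2 := congrArg Fin.val h
      rw [Fin.val_ofNat, Fin.val_ofNat, Nat.mod_eq_of_lt h1, Nat.mod_eq_of_lt h1'] at h2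
      exact Fin.ext (hinj b b.2 b' b'.2 ((hlow b).2 hb) ((hlow b').2 hb') h2)
  · rintro ⟨f, hf, hinj⟩
    have key : ∀ b (hb : b < x.n + 1), ((f (Fin.ofNat (x.n + 1) b) : Fin (x.n + 1)) : ℕ)
        = f ⟨b, hb⟩ := fun b hb => by
      congr; exact Fin.ext (by simp [Nat.mod_eq_of_lt hb])
    refine ⟨fun b => f (Fin.ofNat (x.n + 1) b), fun b hb hl => ?_,
      fun b hb b' hb' hl hl' h => ?_⟩
    · have hb₀ : b < x.n + 1 := hb
      simp only [key b hb₀]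
      exact ⟨Fin.is_lt _, (hhelp _ ⟨b, hb₀⟩).2 (hf _ ((hlow ⟨b, hb₀⟩).1 hl))⟩
    · have hb₀ : b < x.n + 1 := hb
      have hb₁ : b' < x.n + 1 := hb'
      simp only [key b hb₀, key b' hb₁] at h
      exact congrArg Fin.val (hinj ((hlow ⟨b, hb₀⟩).1 hl) ((hlow ⟨b', hb₁⟩).1 hl') (Fin.ext h))

theorem reg_solve_eq_zero_iff :
    (solve.eval (prepare.eval (init x.encode))).reg 10 = 0 ↔ x.inst.EWSA 1 := by
  rw [Instance.ewsa_one_iff_helpable, ← perfect_iff_helpable]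
  refine x.stored_prepare.solve rfl rfl ?_
  -- The word contains the `N * N` entries of the adjacency matrix and a header, so its length is
  -- large enough as a number of rounds.
  have : (prepare.eval (init x.encode)).reg 0 = x.encode.length := rfl
  rw [this, length_encode]
  simp only [table]
  omega

end NumberedInstance

/-- Only registers `0`, `1`, `2` bound loops: the word length and the numbers of agents and
resources, none of them above the word length because the matrices are written out. The target, in
register `3`, may be exponential in the input size and is only compared. -/
theorem solvableInPolyTime_ewsa_one :
    SolvableInPolyTime NumberedInstance.encode (fun x => x.inst.EWSA 1) := by
  refine solvableInPolyTime_of_cmd prepare solve answer 3 12 (by decide) rfl rfl rfl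
    (fun x z hz => ?_) (fun x hx => ?_) (fun x hx => ?_) (by decide)
  · have hlen := length_le_inputSize x.encode
    rw [NumberedInstance.length_encode] at hlen
    have hm : x.m ≤ (x.n + 1) * x.m := Nat.le_mul_of_pos_left _ (by omega)
    have hn : x.n + 1 ≤ (x.n + 1) * (x.n + 1) := Nat.le_mul_of_pos_left _ (by omega)
    have h0 : (prepare.eval (init x.encode)).reg 0 = x.encode.length := rfl
    have h1 : (prepare.eval (init x.encode)).reg 1 = x.n + 1 := rfl
    have h2 : (prepare.eval (init x.encode)).reg 2 = x.m := rfl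
    interval_cases z
    · rw [h0]; exact length_le_inputSize _
    · rw [h1]; omega
    · rw [h2]; omega
  · have := x.reg_solve_eq_zero_iff.2 hx
    simp [answer, Cmd.eval, Expr.eval, this]
  · have := mt x.reg_solve_eq_zero_iff.1 hx
    simp only [answer, Cmd.eval, Expr.eval, Memory.reg_setReg, if_true]
    omega

end Sharing

theorem mainTheorem9 :
    RAM.SolvableInPolyTime Sharing.NumberedInstance.encode (fun x => x.inst.EWSA 1) ∧
    ∀ (A R : Type*) [Fintype A] [Fintype R] [Nonempty A] (I : Sharing.Instance A R),
      I.helpGraph.IsBipartiteWith (I.upper : Set A) (I.lower : Set A) ∧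
      (I.EWSA 1 ↔
        ∃ M : I.helpGraph.Subgraph, M.IsMatching ∧ M.edgeSet.ncard = I.lower.card) :=
  ⟨Sharing.solvableInPolyTime_ewsa_one, fun _ _ _ _ _ I =>
    ⟨I.helpGraph_isBipartiteWith, Sharing.Instance.ewsa_one_iff_helpable.trans
      ⟨Sharing.Instance.exists_matching_of_helpable,
        fun ⟨_, hM, hcard⟩ => Sharing.Instance.helpable_of_matching hM hcard⟩⟩⟩
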